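/- Let $(M,g)$ be a closed (that is, compact and without boundary), connected and oriented smooth Riemannian manifold with $\dim M\neq 1$, and let $\mu$ be its canonical volume form. Let $\mathfrak X(M)$ be the Lie algebra of smooth vector fields on $M$ with the $C^\infty$ (Fréchet) topology, the usual Lie bracket, and the $L^2$ scalar product $\langle X,Y\rangle=\int_M g(X,Y)\,\mu$, and let $\mathfrak X(M,\mu)=\{X\in\mathfrak X(M): L_X\mu=0\}$ be the set of divergence free vector fields. Then there does not exist a closed Lie subalgebra $\mathfrak g\subseteq\mathfrak X(M)$ with $\mathfrak X(M,\mu)\subsetneq\mathfrak g$ such that both of the following hold: 1. there is a bounded linear map $\mathrm{ad}(\cdot)^{\mathsf T}:\mathfrak g\to L(\mathfrak g)$ with $\langle \mathrm{ad}(X)^{\mathsf T}Y,Z\rangle=\langle Y,[X,Z]\rangle$ for all $X,Y,Z\in\mathfrak g$. Here $L(\mathfrak g)$ is the space of continuous linear maps $\mathfrak g\to\mathfrak g$ with the topology of uniform convergence on bounded sets, and bounded means that bounded sets are mapped to bounded sets; 2. $\mathfrak X(M,\mu)$ is totally geodesic in $\mathfrak g$, i.e. $\mathrm{ad}(X)^{\mathsf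 T}X\in\mathfrak X(M,\mu)$ for all $X\in\mathfrak X(M,\mu)$. -/

import Mathlib

open Bundle Manifold MeasureTheory Set Filter
open scoped ContDiff Topology UniformConvergence

noncomputable section

namespace VolGeodesic

theorem two_le_infty : (2 : ℕ∞ω) ≤ ∞ := WithTop.coe_le_coe.2 le_top

theorem three_le_infty : (3 : ℕ∞ω) ≤ ∞ := WithTop.coe_le_coe.2 le_top

/-! ### The Lie algebra of smooth vector fields -/

section VectorFields

variable (n : ℕ) (M : Type*) [TopologicalSpace M]
  [ChartedSpace (EuclideanSpace ℝ (Fin n)) M] [IsManifold (𝓡 n) ∞ M]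

/-- The real vector space `𝔛(M)` of smooth vector fields on `M`. -/
abbrev SmoothVF : Type _ :=
  Cₛ^∞⟮𝓡 n; EuclideanSpace ℝ (Fin n), (TangentSpace (𝓡 n) : M → Type _)⟯

variable {n M}

theorem SmoothVF.contMDiffAt (X : SmoothVF n M) {k : ℕ∞ω} (hk : k ≤ ∞) (x : M) :
    ContMDiffAt (𝓡 n) ((𝓡 n).prod 𝓘(ℝ, EuclideanSpace ℝ (Fin n))) k
      (fun y ↦ (X y : TangentBundle (𝓡 n) M)) x :=
  (X.contMDiff x).of_le hk

theorem SmoothVF.mdifferentiableAt (X : SmoothVF n M) (x : M) :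
    MDifferentiableAt (𝓡 n) ((𝓡 n).prod 𝓘(ℝ, EuclideanSpace ℝ (Fin n)))
      (fun y ↦ (X y : TangentBundle (𝓡 n) M)) x :=
  (X.contMDiff x).mdifferentiableAt (by simp)

/-- The usual Lie bracket `[X, Y]` of vector fields. -/
def bracketVF (X Y : SmoothVF n M) : SmoothVF n M where
  toFun := VectorField.mlieBracket (𝓡 n) X Y
  contMDiff_toFun := by
    have : IsManifold (𝓡 n) (∞ + 1) M := (inferInstance : IsManifold (𝓡 n) ∞ M)
    have : IsManifold (𝓡 n) (minSmoothness ℝ 2) M := by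
      rw [minSmoothness_of_isRCLikeNormedField]
      exact IsManifold.of_le two_le_infty
    have : IsManifold (𝓡 n) (minSmoothness ℝ 3) M := by
      rw [minSmoothness_of_isRCLikeNormedField]
      exact IsManifold.of_le three_le_infty
    exact ContDiff.mlieBracket_vectorField (m := ⊤) (n := ⊤) X.contMDiff Y.contMDiff
      (by simp [minSmoothness_of_isRCLikeNormedField])

instance : LieRing (SmoothVF n M) where
  bracket := bracketVF
  add_lie X Y Z := by
    ext x
    have : IsManifold (𝓡 n) 2 M := IsManifold.of_le two_le_infty
    exact VectorField.mlieBracket_add_left (X.mdifferentiableAt x) (Y.mdifferentiableAt x)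
  lie_add X Y Z := by
    ext x
    have : IsManifold (𝓡 n) 2 M := IsManifold.of_le two_le_infty
    exact VectorField.mlieBracket_add_right (Y.mdifferentiableAt x) (Z.mdifferentiableAt x)
  lie_self X := by
    ext x
    exact congrFun VectorField.mlieBracket_self x
  leibniz_lie X Y Z := by
    ext x
    have : IsManifold (𝓡 n) (minSmoothness ℝ 3) M := by
      rw [minSmoothness_of_isRCLikeNormedField]
      exact IsManifold.of_le three_le_infty
    have h : minSmoothness ℝ 2 ≤ ∞ := by
      rw [minSmoothness_of_isRCLikeNormedField]; exact two_le_infty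
    exact VectorField.leibniz_identity_mlieBracket_apply
      (X.contMDiffAt h x) (Y.contMDiffAt h x) (Z.contMDiffAt h x)

instance : LieAlgebra ℝ (SmoothVF n M) where
  lie_smul c X Y := by
    ext x
    have : IsManifold (𝓡 n) 2 M := IsManifold.of_le two_le_infty
    exact VectorField.mlieBracket_const_smul_right (Y.mdifferentiableAt x)

/-- The representative of the vector field `X` in the preferred chart `φ` at `p`: the map
`y ↦ Dφ (X (φ⁻¹ y))`, relevant for `y` in the (open) image of `φ`. -/
def localRep (p : M) (X : SmoothVF n M) (y : EuclideanSpace ℝ (Fin n)) :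
    EuclideanSpace ℝ (Fin n) :=
  (trivializationAt (EuclideanSpace ℝ (Fin n)) (TangentSpace (𝓡 n) : M → Type _) p
    (X ((extChartAt (𝓡 n) p).symm y) : TangentBundle (𝓡 n) M)).2

theorem localRep_contDiffAt (p : M) (X : SmoothVF n M) {y : EuclideanSpace ℝ (Fin n)}
    (hy : y ∈ (extChartAt (𝓡 n) p).target) : ContDiffAt ℝ ∞ (localRep p X) y := by
  have h1 := (Trivialization.contMDiffAt_section_iff (IB := 𝓡 n) (n := ∞)
    (F := EuclideanSpace ℝ (Fin n)) (s := X)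
    (trivializationAt (EuclideanSpace ℝ (Fin n)) (TangentSpace (𝓡 n) : M → Type _) p)
    (x₀ := (extChartAt (𝓡 n) p).symm y)
    (by simpa using (extChartAt (𝓡 n) p).map_target hy)).1 (X.contMDiff _)
  have h2 : ContMDiffAt 𝓘(ℝ, EuclideanSpace ℝ (Fin n)) (𝓡 n) ∞ (extChartAt (𝓡 n) p).symm y :=
    (contMDiffOn_extChartAt_symm p).contMDiffAt
      ((isOpen_extChartAt_target p).mem_nhds hy)
  exact (h1.comp y h2).contDiffAt

theorem localRep_add (p : M) (X Y : SmoothVF n M) {y : EuclideanSpace ℝ (Fin n)}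
    (hy : y ∈ (extChartAt (𝓡 n) p).target) :
    localRep p (X + Y) y = (localRep p X + localRep p Y) y := by
  have hb : (extChartAt (𝓡 n) p).symm y ∈ (trivializationAt (EuclideanSpace ℝ (Fin n))
      (TangentSpace (𝓡 n) : M → Type _) p).baseSet := by
    simpa using (extChartAt (𝓡 n) p).map_target hy
  exact ((trivializationAt (EuclideanSpace ℝ (Fin n))
    (TangentSpace (𝓡 n) : M → Type _) p).linear ℝ hb).map_add _ _

theorem localRep_smul (p : M) (c : ℝ) (X : SmoothVF n M) {y : EuclideanSpace ℝ (Fin n)}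
    (hy : y ∈ (extChartAt (𝓡 n) p).target) :
    localRep p (c • X) y = (c • localRep p X) y := by
  have hb : (extChartAt (𝓡 n) p).symm y ∈ (trivializationAt (EuclideanSpace ℝ (Fin n))
      (TangentSpace (𝓡 n) : M → Type _) p).baseSet := by
    simpa using (extChartAt (𝓡 n) p).map_target hy
  exact ((trivializationAt (EuclideanSpace ℝ (Fin n))
    (TangentSpace (𝓡 n) : M → Type _) p).linear ℝ hb).map_smul _ _

/-- The `k`-th derivative of the representative of a vector field in the preferred chart at `p`,
as an element of the space of functions on the image of the chart with the topology of uniform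
convergence on compact sets. -/
def jet (p : M) (k : ℕ) : SmoothVF n M →ₗ[ℝ]
    ((extChartAt (𝓡 n) p).target →ᵤ[{K | IsCompact K}]
      (EuclideanSpace ℝ (Fin n) [×k]→L[ℝ] EuclideanSpace ℝ (Fin n))) where
  toFun X := UniformOnFun.ofFun _ fun y ↦ iteratedFDeriv ℝ k (localRep p X) y
  map_add' X Y := by
    refine (UniformOnFun.ofFun _).injective.eq_iff.2 (funext fun y ↦ ?_)
    have hk : ((k : ℕ∞) : ℕ∞ω) ≤ ∞ := by exact_mod_cast le_top
    have he : localRep p (X + Y) =ᶠ[𝓝 (y : EuclideanSpace ℝ (Fin n))]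
        localRep p X + localRep p Y := by
      filter_upwards [(isOpen_extChartAt_target p).mem_nhds y.2] with z hz
      exact localRep_add p X Y hz
    exact (he.iteratedFDeriv ℝ k).eq_of_nhds.trans <| iteratedFDeriv_add_apply ((localRep_contDiffAt p X y.2).of_le hk)
      ((localRep_contDiffAt p Y y.2).of_le hk)
  map_smul' c X := by
    refine (UniformOnFun.ofFun _).injective.eq_iff.2 (funext fun y ↦ ?_)
    have hk : ((k : ℕ∞) : ℕ∞ω) ≤ ∞ := by exact_mod_cast le_top
    have he : localRep p (c • X) =ᶠ[𝓝 (y : EuclideanSpace ℝ (Fin n))] c • localRep p X := by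
      filter_upwards [(isOpen_extChartAt_target p).mem_nhds y.2] with z hz
      exact localRep_smul p c X hz
    exact (he.iteratedFDeriv ℝ k).eq_of_nhds.trans <| iteratedFDeriv_const_smul_apply ((localRep_contDiffAt p X y.2).of_le hk)

/-- The (Fréchet) `C^∞`-topology on `𝔛(M)`: uniform convergence of all derivatives, in charts, on
compact sets. -/
instance : TopologicalSpace (SmoothVF n M) :=
  ⨅ (p : M) (k : ℕ), TopologicalSpace.induced (jet p k) inferInstance

theorem isTopologicalAddGroup_uniformOnFun {α G : Type*} (𝔖 : Set (Set α))
    [SeminormedAddCommGroup G] : IsTopologicalAddGroup (α →ᵤ[𝔖] G) := inferInstance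

instance : IsTopologicalAddGroup (SmoothVF n M) :=
  topologicalAddGroup_iInf fun p ↦ topologicalAddGroup_iInf fun k ↦
    haveI := isTopologicalAddGroup_uniformOnFun (α := (extChartAt (𝓡 n) p).target)
      (G := EuclideanSpace ℝ (Fin n) [×k]→L[ℝ] EuclideanSpace ℝ (Fin n)) {K | IsCompact K}
    topologicalAddGroup_induced (jet p k)

theorem continuous_jet (p : M) (k : ℕ) : Continuous (jet p k : SmoothVF n M → _) :=
  continuous_iInf_dom (i := p) (continuous_iInf_dom (i := k) continuous_induced_dom)

instance : ContinuousConstSMul ℝ (SmoothVF n M) where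
  continuous_const_smul c := by
    refine continuous_iInf_rng.2 fun p ↦ continuous_iInf_rng.2 fun k ↦
      continuous_induced_rng.2 ?_
    have h : (jet p k : SmoothVF n M → _) ∘ (fun X ↦ c • X) = fun X ↦ c • jet p k X :=
      funext fun X ↦ (jet p k).map_smul c X
    rw [h]
    exact (continuous_jet p k).const_smul c

instance (𝔤 : LieSubalgebra ℝ (SmoothVF n M)) : IsTopologicalAddGroup 𝔤 :=
  topologicalAddGroup_induced 𝔤.subtype

instance (𝔤 : LieSubalgebra ℝ (SmoothVF n M)) : ContinuousConstSMul ℝ 𝔤 :=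
  Topology.IsInducing.subtypeVal.continuousConstSMul (id : ℝ → ℝ) rfl

end VectorFields

/-! ### Orientations and the Riemannian volume -/

section Volume

variable {n : ℕ} {M : Type*} [TopologicalSpace M]
  [ChartedSpace (EuclideanSpace ℝ (Fin n)) M] [IsManifold (𝓡 n) ∞ M]

variable (n M) in
/-- An orientation of the manifold `M`: a choice of an orientation of each tangent space which is
locally constant in the preferred chart around any point. -/
structure ManifoldOrientation where
  /-- The orientation of the tangent space at `x`. -/
  at' (x : M) : Orientation ℝ (TangentSpace (𝓡 n) x) (Fin n)
  locallyConstant (p : M) : ∃ o : Orientation ℝ (EuclideanSpace ℝ (Fin n)) (Fin n),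
    ∀ᶠ x in 𝓝 p, ∀ hx : x ∈ (trivializationAt (EuclideanSpace ℝ (Fin n))
        (TangentSpace (𝓡 n) : M → Type _) p).baseSet,
      Orientation.map (Fin n) ((trivializationAt (EuclideanSpace ℝ (Fin n))
        (TangentSpace (𝓡 n) : M → Type _) p).continuousLinearEquivAt ℝ x hx).toLinearEquiv
        (at' x) = o

variable [RiemannianBundle (fun x : M ↦ TangentSpace (𝓡 n) x)]

instance factFinrankTangent (x : M) : Fact (Module.finrank ℝ (TangentSpace (𝓡 n) x) = n) :=
  ⟨finrank_euclideanSpace_fin⟩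

/-- The canonical volume form `μ` of the oriented Riemannian manifold `M`: it takes the value `1`
on positively oriented orthonormal bases of the tangent spaces. -/
def volForm (o : ManifoldOrientation n M) (x : M) :
    TangentSpace (𝓡 n) x [⋀^Fin n]→ₗ[ℝ] ℝ :=
  (o.at' x).volumeForm

/-- The Lie derivative `L_X μ` of the volume form, evaluated on vector fields `V₁, …, Vₙ`:
`(L_X μ)(V₁, …, Vₙ) = X (μ(V₁, …, Vₙ)) - ∑ᵢ μ(V₁, …, [X, Vᵢ], …, Vₙ)`. -/
def lieDerivVolForm (o : ManifoldOrientation n M) (X : SmoothVF n M)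
    (V : Fin n → SmoothVF n M) (x : M) : ℝ :=
  mvfderiv (𝓡 n) (fun y ↦ volForm o y fun i ↦ V i y) x (X x)
    - ∑ i, volForm o x (Function.update (fun j ↦ V j x) i (⁅X, V i⁆ x))

/-- The set `𝔛(M, μ)` of divergence free vector fields, i.e. those with `L_X μ = 0`. -/
def divergenceFree (o : ManifoldOrientation n M) : Set (SmoothVF n M) :=
  {X | ∀ V x, lieDerivVolForm o X V x = 0}

/-- The coefficient `μ(∂₁, …, ∂ₙ)` of the volume form at `x` with respect to the coordinate vector
fields of the preferred chart at `p`. -/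
def volCoeff (o : ManifoldOrientation n M) (p x : M) : ℝ :=
  volForm o x fun i ↦ (trivializationAt (EuclideanSpace ℝ (Fin n))
    (TangentSpace (𝓡 n) : M → Type _) p).symm x (EuclideanSpace.basisFun (Fin n) ℝ i)

variable [T2Space M] [CompactSpace M]

variable (n M) in
/-- A smooth partition of unity subordinate to the domains of the preferred charts. -/
def chartPartition : SmoothPartitionOfUnity M (𝓡 n) M univ :=
  (SmoothPartitionOfUnity.exists_isSubordinate_chartAt_source (𝓡 n) M).choose

variable [MeasurableSpace M] [BorelSpace M]

/-- Integration against the volume form, `f ↦ ∫_M f μ`, as a measure on `M`: by means of a partition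
of unity `(ρ_p)` it is `∑ₚ ∫ ρ_p f |μ(∂₁, …, ∂ₙ)| dx¹ ⋯ dxⁿ`, computed in the chart at `p`.
The absolute value makes up for charts that reverse the orientation. -/
def volMeasure (o : ManifoldOrientation n M) : Measure M :=
  Measure.sum fun p : M ↦
    ((volume.restrict (extChartAt (𝓡 n) p).target).withDensity fun y ↦
      ENNReal.ofReal (chartPartition n M p ((extChartAt (𝓡 n) p).symm y) *
        |volCoeff o p ((extChartAt (𝓡 n) p).symm y)|)).map (extChartAt (𝓡 n) p).symm

/-- The `L²` scalar product `∫_M g(X, Y) μ` of vector fields. -/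
def innerL2 (o : ManifoldOrientation n M) (X Y : SmoothVF n M) : ℝ :=
  ∫ x, inner ℝ (X x) (Y x) ∂(volMeasure o)

/-! ### Transposes of the adjoint representation, totally geodesic subalgebras -/

/-- `adT` is the map `ad(·)ᵀ : 𝔤 → L(𝔤)` where `ad(X)ᵀ` is the `L²`-adjoint of
`ad(X) = [X, ·]` on `𝔤`. -/
def IsAdTranspose (o : ManifoldOrientation n M) (𝔤 : LieSubalgebra ℝ (SmoothVF n M))
    (adT : 𝔤 →ₗ[ℝ] (𝔤 →L[ℝ] 𝔤)) : Prop :=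
  ∀ X Y Z : 𝔤, innerL2 o (adT X Y : 𝔤) Z = innerL2 o Y (⁅X, Z⁆ : 𝔤)

/-- A linear map `𝔤 → L(𝔤)` is bounded if it maps bounded sets to bounded sets, where `L(𝔤)`
carries the topology of uniform convergence on bounded sets. -/
def IsBoundedOperatorValued {𝔤 : LieSubalgebra ℝ (SmoothVF n M)}
    (A : 𝔤 →ₗ[ℝ] (𝔤 →L[ℝ] 𝔤)) : Prop :=
  ∀ B : Set 𝔤, Bornology.IsVonNBounded ℝ B → Bornology.IsVonNBounded ℝ (A '' B)

/-- `𝔥 ⊆ 𝔤` is totally geodesic in `𝔤`, given the transpose `adT` of the adjoint representation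
of `𝔤`: one has `ad(X)ᵀ X ∈ 𝔥` for all `X ∈ 𝔥`. -/
def IsTotallyGeodesic {𝔤 : LieSubalgebra ℝ (SmoothVF n M)}
    (adT : 𝔤 →ₗ[ℝ] (𝔤 →L[ℝ] 𝔤)) (𝔥 : Set (SmoothVF n M)) : Prop :=
  ∀ X : 𝔤, (X : SmoothVF n M) ∈ 𝔥 → (adT X X : SmoothVF n M) ∈ 𝔥

end Volume

end VolGeodesic

end

/-! The obstruction is found by pairing with gradients. If X is divergence free and 𝔛(M,μ) is
totally geodesic, then ad(X)ᵀX is divergence free, hence L²-orthogonal to every gradient field Z in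
𝔤 supported in a chart. The defining identity of the transpose then gives ∫ g(X,[X,Z]) μ = 0. It
suffices to find one gradient Z in 𝔤 and one divergence free X for which this integral is positive.

Such a Z exists because 𝔤 is locally everything. Let Y in 𝔤 have divergence h ≠ 0. Since h
integrates to zero and M is connected, h is not constant, so dh(q) ≠ 0 at some q. Membership in 𝔤
depends only on the divergence (`mem_of_divVF_eq`). For F divergence free with support in a chart,
[F,Y] and hF have the same divergence F(h), so hF lies in 𝔤. Take F = ρ⁻¹ curl ψ, with ρ the
Riemannian density and curl ψ = ∂_vψ u - ∂_uψ v. As curl(ψh) = h curl ψ + ψ curl h, all fields ρ⁻¹ψ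
curl h with ψ an arbitrary test function lie in 𝔤 (`chartMem_smul_curlField`). These are tangent to
the level sets of h. A suitable ψ makes the divergence of such a field have a differential at q
independent of dh(q) (`exists_chartDiv_independent`), and the curls of the two divergences together
generate every field supported near q (`exists_nhds_chartMem`). This needs n ≥ 2; for n = 0 every
field is divergence free and strict inclusion is already impossible.

For the integral, write [X,Z] = DZ·X - DX·Z and integrate by parts
(`setIntegral_metric_lieBracket_pos`). The integrand becomes the quadratic form g(X, DZ·X) + (D_Z
g)(X,X)/2 + (div Z) g(X,X)/2. Let Z be the gradient of a cut-off of half the squared distance to q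
in the constant metric g_q (`exists_gradField_radial`). Then Z(q) = 0 and DZ(q) = id, so at q the
form is (1 + n/2) g, and it stays positive definite nearby. A divergence free X with small support
around q and X(q) ≠ 0 gives the contradiction (`not_isTotallyGeodesic`). -/

namespace VolGeodesic

set_option linter.unusedSectionVars false
set_option maxSynthPendingDepth 3

/-! ### Divergences of vector fields on a vector space -/

section Euclid

variable {E : Type*} [NormedAddCommGroup E] [NormedSpace ℝ E] [FiniteDimensional ℝ E]

variable (E) in
/-- The trace as a continuous linear functional. -/
noncomputable def traceL : (E →L[ℝ] E) →L[ℝ] ℝ :=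
  LinearMap.toContinuousLinearMap ((LinearMap.trace ℝ E) ∘ₗ ContinuousLinearMap.coeLM ℝ)

theorem traceL_apply (A : E →L[ℝ] E) : traceL E A = LinearMap.trace ℝ E A := rfl

theorem traceL_smulRight (f : E →L[ℝ] ℝ) (v : E) : traceL E (f.smulRight v) = f v := by
  rw [traceL_apply]
  exact LinearMap.trace_smulRight (f : E →ₗ[ℝ] ℝ) v

theorem traceL_comp_comm (A B : E →L[ℝ] E) : traceL E (A ∘L B) = traceL E (B ∘L A) := by
  rw [traceL_apply, traceL_apply]
  exact LinearMap.trace_mul_comm ℝ (A : E →ₗ[ℝ] E) (B : E →ₗ[ℝ] E)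

/-- The divergence of a vector field with respect to Lebesgue measure. -/
noncomputable def eDiv (F : E → E) (y : E) : ℝ := traceL E (fderiv ℝ F y)

/-- The divergence of a vector field with respect to the measure with density `r`. -/
noncomputable def wDiv (r : E → ℝ) (F : E → E) (y : E) : ℝ :=
  eDiv F y + (r y)⁻¹ * fderiv ℝ r y (F y)

theorem eDiv_smul {f : E → ℝ} {F : E → E} {y : E} (hf : DifferentiableAt ℝ f y)
    (hF : DifferentiableAt ℝ F y) :
    eDiv (fun z ↦ f z • F z) y = f y * eDiv F y + fderiv ℝ f y (F y) := by
  rw [eDiv, fderiv_fun_smul hf hF, map_add, map_smul, traceL_smulRight, eDiv, smul_eq_mul]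

theorem wDiv_congr {r : E → ℝ} {F H : E → E} {y : E} (h : F =ᶠ[𝓝 y] H) :
    wDiv r F y = wDiv r H y := by
  rw [wDiv, wDiv, eDiv, eDiv, h.fderiv_eq, h.eq_of_nhds]

theorem wDiv_add {r : E → ℝ} {F H : E → E} {y : E} (hF : DifferentiableAt ℝ F y)
    (hH : DifferentiableAt ℝ H y) : wDiv r (F + H) y = wDiv r F y + wDiv r H y := by
  simp only [wDiv, eDiv, fderiv_add hF hH, map_add, Pi.add_apply]
  ring

theorem wDiv_const_smul {r : E → ℝ} {F : E → E} {y : E} (c : ℝ) (hF : DifferentiableAt ℝ F y) :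
    wDiv r (c • F) y = c * wDiv r F y := by
  simp only [wDiv, eDiv, fderiv_const_smul hF, map_smul, Pi.smul_apply, smul_eq_mul]
  ring

theorem wDiv_smul {r f : E → ℝ} {F : E → E} {y : E} (hf : DifferentiableAt ℝ f y)
    (hF : DifferentiableAt ℝ F y) :
    wDiv r (fun z ↦ f z • F z) y = f y * wDiv r F y + fderiv ℝ f y (F y) := by
  simp only [wDiv, eDiv_smul hf hF, map_smul, smul_eq_mul]
  ring

theorem eDiv_density_smul {r : E → ℝ} {F : E → E} {y : E} (hr : DifferentiableAt ℝ r y)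
    (hy : r y ≠ 0) (hF : DifferentiableAt ℝ F y) :
    eDiv (fun z ↦ r z • F z) y = r y * wDiv r F y := by
  rw [eDiv_smul hr hF, wDiv]
  field_simp

/-- Dividing by the density converts Lebesgue divergence into weighted divergence. This is how curls
become divergence free fields for the Riemannian volume. -/
theorem wDiv_inv_smul {r : E → ℝ} {F : E → E} {y : E} (hr : DifferentiableAt ℝ r y)
    (hy : r y ≠ 0) (hF : DifferentiableAt ℝ F y) :
    wDiv r (fun z ↦ (r z)⁻¹ • F z) y = (r y)⁻¹ * eDiv F y := by
  have h : eDiv F y = r y * wDiv r (fun z ↦ (r z)⁻¹ • F z) y := by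
    rw [← eDiv_density_smul hr hy (F := fun z ↦ (r z)⁻¹ • F z) ((hr.inv hy).smul hF)]
    have he : F =ᶠ[𝓝 y] fun z ↦ r z • (r z)⁻¹ • F z := by
      filter_upwards [hr.continuousAt.eventually_ne hy] with z hz
      rw [smul_smul, mul_inv_cancel₀ hz, one_smul]
    rw [eDiv, eDiv, he.fderiv_eq]
  rw [h]
  field_simp

theorem hasFDerivAt_fderiv_apply {G : Type*} [NormedAddCommGroup G] [NormedSpace ℝ G]
    {F : E → G} {H : E → E} {y : E}
    (hF : ContDiffAt ℝ 2 F y) (hH : DifferentiableAt ℝ H y) :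
    HasFDerivAt (fun z ↦ fderiv ℝ F z (H z))
      ((fderiv ℝ F y) ∘L (fderiv ℝ H y) + (fderiv ℝ (fderiv ℝ F) y).flip (H y)) y :=
  ((hF.fderiv_right (m := 1) le_rfl).differentiableAt one_ne_zero).hasFDerivAt.clm_apply
    hH.hasFDerivAt

theorem isSymmSndFDerivAt_of_two {G : Type*} [NormedAddCommGroup G] [NormedSpace ℝ G]
    {F : E → G} {y : E} (hF : ContDiffAt ℝ 2 F y) : IsSymmSndFDerivAt ℝ F y :=
  hF.isSymmSndFDerivAt (by simp [minSmoothness_of_isRCLikeNormedField])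

/-- Differentiating DH·F - DF·H gives products of first derivatives, whose traces tr(DH DF) and
tr(DF DH) cancel, and second derivative terms. By symmetry of the second derivative, the traces of
the latter are the derivatives of the divergences. -/
theorem eDiv_lieBracket {F H : E → E} {y : E} (hF : ContDiffAt ℝ 2 F y)
    (hH : ContDiffAt ℝ 2 H y) :
    eDiv (VectorField.lieBracket ℝ F H) y
      = fderiv ℝ (eDiv H) y (F y) - fderiv ℝ (eDiv F) y (H y) := by
  have key : ∀ {F H : E → E}, ContDiffAt ℝ 2 F y → ContDiffAt ℝ 2 H y →
      traceL E ((fderiv ℝ (fderiv ℝ F) y).flip (H y)) = fderiv ℝ (eDiv F) y (H y) := by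
    intro F H hF hH
    have h1 : fderiv ℝ (eDiv F) y = (traceL E) ∘L fderiv ℝ (fderiv ℝ F) y :=
      ((traceL E).hasFDerivAt.comp y
        ((hF.fderiv_right (m := 1) le_rfl).differentiableAt one_ne_zero).hasFDerivAt).fderiv
    rw [h1]
    simp only [ContinuousLinearMap.comp_apply]
    congr 1
    ext w
    exact (isSymmSndFDerivAt_of_two hF) _ _
  have h1 : fderiv ℝ (VectorField.lieBracket ℝ F H) y = _ :=
    ((hasFDerivAt_fderiv_apply hH (hF.differentiableAt two_ne_zero)).sub
      (hasFDerivAt_fderiv_apply hF (hH.differentiableAt two_ne_zero))).fderiv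
  rw [eDiv, h1]
  simp only [map_sub, map_add]
  rw [key hH hF, key hF hH, traceL_comp_comm (fderiv ℝ H y)]
  ring

theorem eventuallyEq_log_deriv_apply {r : E → ℝ} {y : E} (hr : ContDiffAt ℝ 2 r y)
    (hy : 0 < r y) (F : E → E) :
    (fun z ↦ (r z)⁻¹ * fderiv ℝ r z (F z))
      =ᶠ[𝓝 y] fun z ↦ fderiv ℝ (fun w ↦ Real.log (r w)) z (F z) := by
  filter_upwards [hr.continuousAt.eventually (lt_mem_nhds hy),
    hr.eventually (by simp)] with z hz hrz
  rw [((hrz.differentiableAt two_ne_zero).hasFDerivAt.log hz.ne').fderiv]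
  simp

theorem differentiableAt_eDiv {F : E → E} {y : E} (hF : ContDiffAt ℝ 2 F y) :
    DifferentiableAt ℝ (eDiv F) y :=
  (traceL E).differentiableAt.comp y
    ((hF.fderiv_right (m := 1) le_rfl).differentiableAt one_ne_zero)

/-- With L = log r the weighted divergence is `eDiv F` plus dL(F). The extra terms contribute
F(dL(H)) - H(dL(F)), which is dL([F,H]) because the Hessian of L is symmetric. -/
theorem wDiv_lieBracket {r : E → ℝ} {F H : E → E} {y : E} (hr : ContDiffAt ℝ 2 r y)
    (hy : 0 < r y) (hF : ContDiffAt ℝ 2 F y) (hH : ContDiffAt ℝ 2 H y) :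
    wDiv r (VectorField.lieBracket ℝ F H) y
      = fderiv ℝ (wDiv r H) y (F y) - fderiv ℝ (wDiv r F) y (H y) := by
  set L : E → ℝ := fun w ↦ Real.log (r w)
  have hL : ContDiffAt ℝ 2 L y := hr.log hy.ne'
  have hLy : fderiv ℝ L y = (r y)⁻¹ • fderiv ℝ r y :=
    ((hr.differentiableAt two_ne_zero).hasFDerivAt.log hy.ne').fderiv
  have key : ∀ {F : E → E}, ContDiffAt ℝ 2 F y → fderiv ℝ (wDiv r F) y =
      fderiv ℝ (eDiv F) y + ((fderiv ℝ L y) ∘L (fderiv ℝ F y)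
        + (fderiv ℝ (fderiv ℝ L) y).flip (F y)) := by
    intro F hF
    have h : wDiv r F =ᶠ[𝓝 y] fun z ↦ eDiv F z + fderiv ℝ L z (F z) := by
      filter_upwards [eventuallyEq_log_deriv_apply hr hy F] with z hz
      rw [wDiv, hz]
    rw [h.fderiv_eq]
    exact ((differentiableAt_eDiv hF).hasFDerivAt.add
      (hasFDerivAt_fderiv_apply hL (hF.differentiableAt two_ne_zero))).fderiv
  have hs : fderiv ℝ (fderiv ℝ L) y (F y) (H y) = fderiv ℝ (fderiv ℝ L) y (H y) (F y) :=
    (isSymmSndFDerivAt_of_two hL) _ _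
  have hl : (r y)⁻¹ * fderiv ℝ r y (VectorField.lieBracket ℝ F H y)
      = fderiv ℝ L y (VectorField.lieBracket ℝ F H y) := by
    rw [hLy]; simp
  rw [key hF, key hH, wDiv, hl, eDiv_lieBracket hF hH]
  simp only [VectorField.lieBracket, map_sub, _root_.add_apply,
    ContinuousLinearMap.comp_apply, ContinuousLinearMap.flip_apply]
  rw [hs]
  ring

theorem contDiffAt_eDiv {F : E → E} {y : E} (hF : ContDiffAt ℝ ∞ F y) :
    ContDiffAt ℝ ∞ (eDiv F) y :=
  (traceL E).contDiff.contDiffAt.comp y (hF.fderiv_right (m := ∞) (by simp))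

theorem contDiffAt_wDiv {r : E → ℝ} {F : E → E} {y : E} (hr : ContDiffAt ℝ ∞ r y)
    (hy : r y ≠ 0) (hF : ContDiffAt ℝ ∞ F y) : ContDiffAt ℝ ∞ (wDiv r F) y :=
  (contDiffAt_eDiv hF).add
    ((hr.inv hy).mul ((hr.fderiv_right (m := ∞) (by simp)).clm_apply hF))

/-- The vector field `∂_v ψ u - ∂_u ψ v`. -/
noncomputable def curlField (ψ : E → ℝ) (u v : E) (y : E) : E :=
  fderiv ℝ ψ y v • u - fderiv ℝ ψ y u • v

theorem contDiffAt_curlField {ψ : E → ℝ} {u v y : E} (h : ContDiffAt ℝ ∞ ψ y) :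
    ContDiffAt ℝ ∞ (curlField ψ u v) y := by
  have h1 : ContDiffAt ℝ ∞ (fderiv ℝ ψ) y := h.fderiv_right (m := ∞) (by simp)
  exact ((h1.clm_apply contDiffAt_const).smul contDiffAt_const).sub
    ((h1.clm_apply contDiffAt_const).smul contDiffAt_const)

theorem eDiv_curlField {ψ : E → ℝ} {u v y : E} (h : ContDiffAt ℝ 2 ψ y) :
    eDiv (curlField ψ u v) y = 0 := by
  have h1 : ∀ w : E, HasFDerivAt (fun z ↦ fderiv ℝ ψ z w)
      ((fderiv ℝ (fderiv ℝ ψ) y).flip w) y := fun w ↦ by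
    simpa using hasFDerivAt_fderiv_apply h (differentiableAt_const w)
  have h2 : fderiv ℝ (curlField ψ u v) y = _ :=
    (((h1 v).smul_const u).sub ((h1 u).smul_const v)).fderiv
  rw [eDiv, h2, map_sub, traceL_smulRight, traceL_smulRight, ContinuousLinearMap.flip_apply,
    ContinuousLinearMap.flip_apply, isSymmSndFDerivAt_of_two h u v, sub_self]

theorem wDiv_inv_smul_curlField {r ψ : E → ℝ} {u v y : E} (hr : ContDiffAt ℝ ∞ r y)
    (hy : r y ≠ 0) (h : ContDiffAt ℝ ∞ ψ y) :
    wDiv r (fun z ↦ (r z)⁻¹ • curlField ψ u v z) y = 0 := by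
  rw [wDiv_inv_smul (hr.differentiableAt (by simp)) hy
    ((contDiffAt_curlField h).differentiableAt (by simp)), eDiv_curlField
    (h.of_le two_le_infty), mul_zero]

theorem contDiffAt_sum_smul_smulRight {n : ℕ} {c : Fin n → E →L[ℝ] ℝ} {g : Fin n → Fin n → E → ℝ}
    {y : E} (hg : ∀ i j, ContDiffAt ℝ ∞ (g i j) y) :
    ContDiffAt ℝ ∞ (fun z ↦ ∑ i, ∑ j, g i j z • (c i).smulRight (c j)) y :=
  ContDiffAt.sum fun i _ ↦ ContDiffAt.sum fun j _ ↦ (hg i j).smul contDiffAt_const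

variable [MeasurableSpace E] [BorelSpace E]

theorem integral_fderiv_eq_zero {f : E → ℝ} (hf : ContDiff ℝ 1 f) (hc : HasCompactSupport f)
    (v : E) (μ : Measure E) [μ.IsAddHaarMeasure] : ∫ y, fderiv ℝ f y v ∂μ = 0 := by
  have hi : Integrable (fun y ↦ fderiv ℝ f y v) μ :=
    ((hf.continuous_fderiv one_ne_zero).clm_apply continuous_const).integrable_of_hasCompactSupport
      (hc.fderiv_apply ℝ v)
  -- Integration by parts against the constant function 1.
  have h := integral_mul_fderiv_eq_neg_fderiv_mul_of_integrable (μ := μ) (f := fun _ : E ↦ (1 : ℝ))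
    (g := f) (v := v) (by simp) (by simpa using hi)
    (by simpa using hf.continuous.integrable_of_hasCompactSupport hc)
    (fun _ _ ↦ differentiableAt_const _) (fun x _ ↦ hf.differentiable one_ne_zero x)
  simpa using h

theorem integral_eDiv_eq_zero {F : E → E} (hF : ContDiff ℝ 1 F) (hc : HasCompactSupport F)
    (μ : Measure E) [μ.IsAddHaarMeasure] : ∫ y, eDiv F y ∂μ = 0 := by
  let b := Module.finBasis ℝ E
  let c : Fin (Module.finrank ℝ E) → E →L[ℝ] ℝ := fun i ↦
    LinearMap.toContinuousLinearMap (b.coord i)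
  have hcc : ∀ i, ContDiff ℝ 1 fun y ↦ c i (F y) := fun i ↦ (c i).contDiff.comp hF
  have hcs : ∀ i, HasCompactSupport fun y ↦ c i (F y) := fun i ↦
    hc.comp_left (g := c i) (map_zero _)
  have h : ∀ y, eDiv F y = ∑ i, fderiv ℝ (fun z ↦ c i (F z)) y (b i) := fun y ↦ by
    rw [eDiv, traceL_apply, LinearMap.trace_eq_matrix_trace ℝ b, Matrix.trace]
    refine Finset.sum_congr rfl fun i _ ↦ ?_
    have hd : HasFDerivAt (fun z ↦ c i (F z)) ((c i) ∘L fderiv ℝ F y) y :=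
      (c i).hasFDerivAt.comp y (hF.differentiable one_ne_zero y).hasFDerivAt
    rw [hd.fderiv]
    simp [LinearMap.toMatrix_apply, c]
  simp_rw [h]
  rw [integral_finsetSum]
  · exact Finset.sum_eq_zero fun i _ ↦ integral_fderiv_eq_zero (hcc i) (hcs i) _ _
  · intro i _
    exact (((hcc i).continuous_fderiv one_ne_zero).clm_apply
      continuous_const).integrable_of_hasCompactSupport ((hcs i).fderiv_apply ℝ _)

end Euclid

/-! ### Alternating maps of top degree -/

section Alternating

variable {n : ℕ}

theorem AlternatingMap.map_clm_apply_eq (α : EuclideanSpace ℝ (Fin n) [⋀^Fin n]→ₗ[ℝ] ℝ)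
    (A : EuclideanSpace ℝ (Fin n) →ₗ[ℝ] EuclideanSpace ℝ (Fin n))
    (v : Fin n → EuclideanSpace ℝ (Fin n)) :
    α (fun i ↦ A (v i)) = LinearMap.det A * α v := by
  have h := α.eq_smul_basis_det (EuclideanSpace.basisFun (Fin n) ℝ).toBasis
  rw [h]
  simp only [AlternatingMap.smul_apply, smul_eq_mul]
  have := (EuclideanSpace.basisFun (Fin n) ℝ).toBasis.det_comp A v
  rw [show (fun i ↦ A (v i)) = A ∘ v from rfl, this]
  ring

/-- The determinant with respect to the standard basis. -/
noncomputable def stdDet (n : ℕ) : EuclideanSpace ℝ (Fin n) [⋀^Fin n]→ₗ[ℝ] ℝ :=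
  (EuclideanSpace.basisFun (Fin n) ℝ).toBasis.det

theorem AlternatingMap.eq_mul_stdDet (α : EuclideanSpace ℝ (Fin n) [⋀^Fin n]→ₗ[ℝ] ℝ)
    (v : Fin n → EuclideanSpace ℝ (Fin n)) :
    α v = α (EuclideanSpace.basisFun (Fin n) ℝ) * stdDet n v := by
  conv_lhs => rw [α.eq_smul_basis_det (EuclideanSpace.basisFun (Fin n) ℝ).toBasis]
  simp [stdDet]

theorem continuous_stdDet : Continuous (stdDet n) := by
  have : (stdDet n : _ → ℝ) = fun v ↦ Matrix.det (Matrix.of fun i j ↦ v j i) := by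
    ext v
    rw [stdDet, Module.Basis.det_apply]
    congr 1
  rw [this]
  refine Continuous.matrix_det (continuous_pi fun i ↦ continuous_pi fun j ↦ ?_)
  exact (EuclideanSpace.proj i).continuous.comp (continuous_apply j)

theorem hasFDerivAt_stdDet {G : Type*} [NormedAddCommGroup G] [NormedSpace ℝ G]
    {g : Fin n → G → EuclideanSpace ℝ (Fin n)} {g' : Fin n → G →L[ℝ] EuclideanSpace ℝ (Fin n)}
    {x : G} (hg : ∀ i, HasFDerivAt (g i) (g' i) x) :
    ∃ D : G →L[ℝ] ℝ, HasFDerivAt (fun y ↦ stdDet n fun i ↦ g i y) D x ∧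
      ∀ w, D w = ∑ i, stdDet n (Function.update (fun j ↦ g j x) i (g' i w)) := by
  let f : ContinuousMultilinearMap ℝ (fun _ : Fin n ↦ EuclideanSpace ℝ (Fin n)) ℝ :=
    ⟨(stdDet n).toMultilinearMap, continuous_stdDet⟩
  refine ⟨_, HasFDerivAt.multilinear_comp f hg, fun w ↦ ?_⟩
  rw [_root_.sum_apply]
  rfl

/-- Both sides are the derivative at t = 0 of det(v₁ + tAv₁, …, vₙ + tAvₙ): on the left by
multilinearity, on the right by factoring out det(1 + tA). -/
theorem stdDet_sum_update (A : EuclideanSpace ℝ (Fin n) →L[ℝ] EuclideanSpace ℝ (Fin n))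
    (v : Fin n → EuclideanSpace ℝ (Fin n)) :
    ∑ i, stdDet n (Function.update v i (A (v i))) = traceL _ A * stdDet n v := by
  obtain ⟨D, hD, hD'⟩ := hasFDerivAt_stdDet (x := (0 : ℝ)) (g := fun i t ↦ v i + t • A (v i))
    (g' := fun i ↦ (ContinuousLinearMap.id ℝ ℝ).smulRight (A (v i)))
    (fun i ↦ ((hasFDerivAt_id (0 : ℝ)).smul_const (A (v i))).const_add (v i))
  have h1 := hD.hasDerivAt
  rw [hD'] at h1
  simp only [zero_smul, add_zero, ContinuousLinearMap.smulRight_apply,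
    ContinuousLinearMap.id_apply, one_smul] at h1
  refine h1.unique ?_
  let b := (EuclideanSpace.basisFun (Fin n) ℝ).toBasis
  set M := LinearMap.toMatrix b b A
  have h2 : (fun t : ℝ ↦ stdDet n fun i ↦ v i + t • A (v i)) =
      fun t ↦ Matrix.det (1 + t • M) * stdDet n v := by
    ext t
    have := AlternatingMap.map_clm_apply_eq (stdDet n) (LinearMap.id + t • (A : _ →ₗ[ℝ] _)) v
    rw [← LinearMap.det_toMatrix b] at this
    simpa using this
  rw [h2]
  refine HasDerivAt.mul_const ?_ _
  have h3 : (fun t : ℝ ↦ Matrix.det (1 + t • M)) = _ :=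
    funext fun t ↦ Matrix.det_one_add_smul t M
  rw [h3, traceL_apply, LinearMap.trace_eq_matrix_trace ℝ b]
  -- Here det(1 + tM) = 1 + t tr M + R(t) t² with R a polynomial, and the last term has derivative
  -- zero at t = 0.
  have h4 := ((((hasDerivAt_id (0 : ℝ)).const_mul M.trace).const_add 1).add
    (((Matrix.det (1 + (Polynomial.X : Polynomial ℝ) •
      M.map Polynomial.C)).divX.divX.hasDerivAt 0).mul ((hasDerivAt_id (0 : ℝ)).pow 2)))
  refine HasDerivAt.congr_deriv (f := fun t ↦ _) h4 ?_
  simp [M]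

end Alternating

/-! ### Vector fields in charts -/

section Charts

variable {n : ℕ} {M : Type*} [TopologicalSpace M]
  [ChartedSpace (EuclideanSpace ℝ (Fin n)) M] [IsManifold (𝓡 n) ∞ M]

/-- The coordinates of tangent vectors at `x` in the preferred chart at `p`. -/
noncomputable def chartCoord (p x : M) :
    TangentSpace (𝓡 n) x →L[ℝ] EuclideanSpace ℝ (Fin n) :=
  (trivializationAt (EuclideanSpace ℝ (Fin n)) (TangentSpace (𝓡 n) : M → Type _)
    p).continuousLinearMapAt ℝ x

/-- The tangent vector at `x` with given coordinates in the preferred chart at `p`. -/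
noncomputable def chartVec (p x : M) :
    EuclideanSpace ℝ (Fin n) →L[ℝ] TangentSpace (𝓡 n) x :=
  (trivializationAt (EuclideanSpace ℝ (Fin n)) (TangentSpace (𝓡 n) : M → Type _)
    p).symmL ℝ x

theorem mem_baseSet {p x : M} (hx : x ∈ (extChartAt (𝓡 n) p).source) :
    x ∈ (trivializationAt (EuclideanSpace ℝ (Fin n))
      (TangentSpace (𝓡 n) : M → Type _) p).baseSet := by
  simpa using hx

theorem chartVec_chartCoord {p x : M} (hx : x ∈ (extChartAt (𝓡 n) p).source)
    (v : TangentSpace (𝓡 n) x) : chartVec p x (chartCoord p x v) = v :=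
  Bundle.Trivialization.symmL_continuousLinearMapAt _ (mem_baseSet hx) v

theorem chartCoord_chartVec {p x : M} (hx : x ∈ (extChartAt (𝓡 n) p).source)
    (v : EuclideanSpace ℝ (Fin n)) : chartCoord p x (chartVec p x v) = v :=
  Bundle.Trivialization.continuousLinearMapAt_symmL _ (mem_baseSet hx) v

theorem localRep_eq (p : M) (X : SmoothVF n M) {y : EuclideanSpace ℝ (Fin n)}
    (hy : y ∈ (extChartAt (𝓡 n) p).target) :
    localRep p X y = chartCoord p ((extChartAt (𝓡 n) p).symm y)
      (X ((extChartAt (𝓡 n) p).symm y)) := by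
  have := Bundle.Trivialization.continuousLinearMapAt_apply_of_mem (R := ℝ)
    (trivializationAt (EuclideanSpace ℝ (Fin n)) (TangentSpace (𝓡 n) : M → Type _) p)
    (mem_baseSet ((extChartAt (𝓡 n) p).map_target hy))
    (X ((extChartAt (𝓡 n) p).symm y))
  exact this.symm

theorem localRep_extChartAt {p x : M} (X : SmoothVF n M)
    (hx : x ∈ (extChartAt (𝓡 n) p).source) :
    localRep p X (extChartAt (𝓡 n) p x) = chartCoord p x (X x) := by
  rw [localRep_eq p X ((extChartAt (𝓡 n) p).map_source hx)]
  rw [(extChartAt (𝓡 n) p).left_inv hx]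

theorem chartVec_localRep {p x : M} (X : SmoothVF n M)
    (hx : x ∈ (extChartAt (𝓡 n) p).source) :
    chartVec p x (localRep p X (extChartAt (𝓡 n) p x)) = X x := by
  rw [localRep_extChartAt X hx, chartVec_chartCoord hx]

/-- Identifies the bundle trivialization, used to define coordinates of vectors, with the derivative
of the chart. Naturality of the Lie bracket and the change of variables formula are about the
latter. -/
theorem mfderiv_extChartAt_symm_eq {p : M} {y : EuclideanSpace ℝ (Fin n)}
    (hy : y ∈ (extChartAt (𝓡 n) p).target) :
    mfderiv 𝓘(ℝ, EuclideanSpace ℝ (Fin n)) (𝓡 n) (extChartAt (𝓡 n) p).symm y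
      = chartVec p ((extChartAt (𝓡 n) p).symm y) := by
  have : IsManifold (𝓡 n) 1 M := IsManifold.of_le (n := ∞) (by simp)
  have h := TangentBundle.symmL_trivializationAt (𝕜 := ℝ) (I := 𝓡 n) (x₀ := p)
    (x := (extChartAt (𝓡 n) p).symm y)
    (by simpa using (extChartAt (𝓡 n) p).map_target hy)
  rw [(extChartAt (𝓡 n) p).right_inv hy] at h
  rw [chartVec, h, modelWithCornersSelf_coe, range_id, mfderivWithin_univ]

theorem mpullback_extChartAt_symm {p : M} (X : SmoothVF n M) {y : EuclideanSpace ℝ (Fin n)}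
    (hy : y ∈ (extChartAt (𝓡 n) p).target) :
    VectorField.mpullback 𝓘(ℝ, EuclideanSpace ℝ (Fin n)) (𝓡 n) (extChartAt (𝓡 n) p).symm X y
      = localRep p X y := by
  have hx := (extChartAt (𝓡 n) p).map_target hy
  rw [VectorField.mpullback_apply, mfderiv_extChartAt_symm_eq hy, localRep_eq p X hy]
  let e : EuclideanSpace ℝ (Fin n) ≃L[ℝ] TangentSpace (𝓡 n) ((extChartAt (𝓡 n) p).symm y) :=
    ContinuousLinearEquiv.equivOfInverse (chartVec p _) (chartCoord p _)
      (chartCoord_chartVec hx) (chartVec_chartCoord hx)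
  have : chartVec p ((extChartAt (𝓡 n) p).symm y) = (e : EuclideanSpace ℝ (Fin n) →L[ℝ]
    TangentSpace (𝓡 n) ((extChartAt (𝓡 n) p).symm y)) := rfl
  rw [this]
  exact DFunLike.congr_fun (ContinuousLinearMap.inverse_equiv e) _

/-- The Lie bracket is natural under pullback, and the local representative is the pullback along
the inverse chart. -/
theorem localRep_lie (p : M) (X Y : SmoothVF n M) {y : EuclideanSpace ℝ (Fin n)}
    (hy : y ∈ (extChartAt (𝓡 n) p).target) :
    localRep p ⁅X, Y⁆ y = VectorField.lieBracket ℝ (localRep p X) (localRep p Y) y := by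
  have : IsManifold (𝓡 n) (minSmoothness ℝ 2) M := by
    rw [minSmoothness_of_isRCLikeNormedField]
    exact IsManifold.of_le two_le_infty
  have : IsManifold (𝓡 n) (minSmoothness ℝ 3) M := by
    rw [minSmoothness_of_isRCLikeNormedField]
    exact IsManifold.of_le three_le_infty
  have h := VectorField.mpullback_mlieBracket (𝕜 := ℝ)
    (I := 𝓘(ℝ, EuclideanSpace ℝ (Fin n))) (I' := 𝓡 n)
    (f := (extChartAt (𝓡 n) p).symm) (x₀ := y) (V := X) (W := Y) (n := ∞)
    (X.mdifferentiableAt _) (Y.mdifferentiableAt _)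
    ((contMDiffOn_extChartAt_symm p).contMDiffAt ((isOpen_extChartAt_target p).mem_nhds hy))
    (by rw [minSmoothness_of_isRCLikeNormedField]; exact two_le_infty)
  rw [← mpullback_extChartAt_symm _ hy]
  refine h.trans ?_
  have he : ∀ X : SmoothVF n M, VectorField.mpullback 𝓘(ℝ, EuclideanSpace ℝ (Fin n)) (𝓡 n)
      (extChartAt (𝓡 n) p).symm X =ᶠ[𝓝 y] localRep p X := fun X ↦ by
    filter_upwards [(isOpen_extChartAt_target p).mem_nhds hy] with z hz
    exact mpullback_extChartAt_symm X hz
  have hE (V W : (z : EuclideanSpace ℝ (Fin n)) →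
      TangentSpace 𝓘(ℝ, EuclideanSpace ℝ (Fin n)) z) :
      VectorField.mlieBracket 𝓘(ℝ, EuclideanSpace ℝ (Fin n)) V W y =
        VectorField.lieBracket ℝ V W y := by
    rw [← VectorField.mlieBracketWithin_univ, VectorField.mlieBracketWithin_eq_lieBracketWithin]
    exact congrFun (VectorField.lieBracketWithin_univ (𝕜 := ℝ)
      (E := EuclideanSpace ℝ (Fin n)) (V := V) (W := W)) y
  rw [Filter.EventuallyEq.mlieBracket_vectorField_eq (he X) (he Y)]
  exact hE _ _

theorem contMDiffAt_chartVec {p x : M} (hx : x ∈ (extChartAt (𝓡 n) p).source)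
    {F : M → EuclideanSpace ℝ (Fin n)}
    (hF : ContMDiffAt (𝓡 n) 𝓘(ℝ, EuclideanSpace ℝ (Fin n)) ∞ F x) :
    ContMDiffAt (𝓡 n) ((𝓡 n).prod 𝓘(ℝ, EuclideanSpace ℝ (Fin n))) ∞
      (fun z ↦ (chartVec p z (F z) : TangentBundle (𝓡 n) M)) x := by
  have h := (Bundle.Trivialization.contMDiffAt_section_iff (IB := 𝓡 n) (n := ∞)
    (F := EuclideanSpace ℝ (Fin n)) (s := fun z ↦ chartVec p z (F z))
    (trivializationAt (EuclideanSpace ℝ (Fin n)) (TangentSpace (𝓡 n) : M → Type _) p)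
    (x₀ := x) (mem_baseSet hx))
  refine h.2 (hF.congr_of_eventuallyEq ?_)
  filter_upwards [(isOpen_extChartAt_source p).mem_nhds hx] with z hz
  have := Bundle.Trivialization.continuousLinearMapAt_apply_of_mem (R := ℝ)
    (trivializationAt (EuclideanSpace ℝ (Fin n)) (TangentSpace (𝓡 n) : M → Type _) p)
    (mem_baseSet hz) (chartVec p z (F z))
  exact this.symm.trans (chartCoord_chartVec hz (F z))

theorem isClosed_symm_image [T2Space M] {p : M} {K : Set (EuclideanSpace ℝ (Fin n))}
    (hK : IsCompact K) (h : K ⊆ (extChartAt (𝓡 n) p).target) :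
    IsClosed ((extChartAt (𝓡 n) p).symm '' K) :=
  (hK.image_of_continuousOn ((continuousOn_extChartAt_symm p).mono h)).isClosed

open Classical in
/-- The smooth vector field on `M` given in the preferred chart at `p` by the field `F` with
compact support in the image of the chart, and by zero off that chart. -/
noncomputable def ofChart [T2Space M] (p : M)
    (F : EuclideanSpace ℝ (Fin n) → EuclideanSpace ℝ (Fin n))
    (hF : ContDiff ℝ ∞ F) (hc : HasCompactSupport F)
    (ht : tsupport F ⊆ (extChartAt (𝓡 n) p).target) : SmoothVF n M where
  toFun x := if x ∈ (extChartAt (𝓡 n) p).source then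
    chartVec p x (F (extChartAt (𝓡 n) p x)) else 0
  contMDiff_toFun x := by
    by_cases hx : x ∈ (extChartAt (𝓡 n) p).source
    · have h1 : ContMDiffAt (𝓡 n) 𝓘(ℝ, EuclideanSpace ℝ (Fin n)) ∞
          (fun z ↦ F (extChartAt (𝓡 n) p z)) x :=
        hF.contMDiff.contMDiffAt.comp x (contMDiffAt_extChartAt' (by simpa using hx))
      refine (contMDiffAt_chartVec hx h1).congr_of_eventuallyEq ?_
      filter_upwards [(isOpen_extChartAt_source p).mem_nhds hx] with z hz
      simp only [if_pos hz]
    · have h0 : ContMDiffAt (𝓡 n) ((𝓡 n).prod 𝓘(ℝ, EuclideanSpace ℝ (Fin n))) ∞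
          (fun z ↦ ((0 : SmoothVF n M) z : TangentBundle (𝓡 n) M)) x :=
        (0 : SmoothVF n M).contMDiff x
      refine h0.congr_of_eventuallyEq ?_
      have hcl := isClosed_symm_image (p := p) hc ht
      -- The image of the support in M is compact, hence closed, and lies inside the chart domain. A
      -- point off the domain therefore has a neighbourhood on which the field is zero.
      have hxn : x ∉ (extChartAt (𝓡 n) p).symm '' tsupport F := by
        rintro ⟨y, hy, rfl⟩
        exact hx ((extChartAt (𝓡 n) p).map_target (ht hy))
      filter_upwards [hcl.isOpen_compl.mem_nhds hxn] with z hz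
      have : (if z ∈ (extChartAt (𝓡 n) p).source then
          chartVec p z (F (extChartAt (𝓡 n) p z)) else 0) = 0 := by
        split_ifs with hzs
        · have : extChartAt (𝓡 n) p z ∉ tsupport F := fun h ↦
            hz ⟨_, h, (extChartAt (𝓡 n) p).left_inv hzs⟩
          rw [image_eq_zero_of_notMem_tsupport this, map_zero]
        · rfl
      rw [this]
      rfl

section OfChart

variable [T2Space M] {p : M} {F : EuclideanSpace ℝ (Fin n) → EuclideanSpace ℝ (Fin n)}
    {hF : ContDiff ℝ ∞ F} {hc : HasCompactSupport F}
    {ht : tsupport F ⊆ (extChartAt (𝓡 n) p).target}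

theorem ofChart_apply {x : M} (hx : x ∈ (extChartAt (𝓡 n) p).source) :
    ofChart p F hF hc ht x = chartVec p x (F (extChartAt (𝓡 n) p x)) :=
  if_pos hx

theorem ofChart_apply_of_notMem {x : M} (hx : x ∉ (extChartAt (𝓡 n) p).source) :
    ofChart p F hF hc ht x = 0 :=
  if_neg hx

theorem localRep_ofChart {y : EuclideanSpace ℝ (Fin n)}
    (hy : y ∈ (extChartAt (𝓡 n) p).target) :
    localRep p (ofChart p F hF hc ht) y = F y := by
  have hx := (extChartAt (𝓡 n) p).map_target hy
  rw [localRep_eq p _ hy, ofChart_apply hx, chartCoord_chartVec hx,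
    (extChartAt (𝓡 n) p).right_inv hy]

theorem localRep_ofChart_eventuallyEq {y : EuclideanSpace ℝ (Fin n)}
    (hy : y ∈ (extChartAt (𝓡 n) p).target) :
    localRep p (ofChart p F hF hc ht) =ᶠ[𝓝 y] F := by
  filter_upwards [(isOpen_extChartAt_target p).mem_nhds hy] with z hz
  exact localRep_ofChart hz

end OfChart

/-- The derivative of the change of charts from `p` to `q` at `x`. -/
noncomputable def chartChange (p q x : M) :
    EuclideanSpace ℝ (Fin n) →L[ℝ] EuclideanSpace ℝ (Fin n) :=
  chartCoord q x ∘L chartVec p x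

theorem hasFDerivAt_chart_change {p q : M} {y : EuclideanSpace ℝ (Fin n)}
    (hy : y ∈ (extChartAt (𝓡 n) p).target)
    (hq : (extChartAt (𝓡 n) p).symm y ∈ (extChartAt (𝓡 n) q).source) :
    HasFDerivAt (extChartAt (𝓡 n) q ∘ (extChartAt (𝓡 n) p).symm)
      (chartChange p q ((extChartAt (𝓡 n) p).symm y)) y := by
  have : IsManifold (𝓡 n) 1 M := IsManifold.of_le (n := ∞) (by simp)
  have h1 : MDifferentiableAt 𝓘(ℝ, EuclideanSpace ℝ (Fin n)) (𝓡 n) (extChartAt (𝓡 n) p).symm y :=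
    ((contMDiffOn_extChartAt_symm (n := ∞) p).contMDiffAt
      ((isOpen_extChartAt_target p).mem_nhds hy)).mdifferentiableAt (by simp)
  have h2 : MDifferentiableAt (𝓡 n) 𝓘(ℝ, EuclideanSpace ℝ (Fin n)) (extChartAt (𝓡 n) q)
      ((extChartAt (𝓡 n) p).symm y) := mdifferentiableAt_extChartAt (by simpa using hq)
  have h3 := (h2.hasMFDerivAt.comp y h1.hasMFDerivAt).hasFDerivAt
  rw [mfderiv_extChartAt_symm_eq hy,
    ← TangentBundle.continuousLinearMapAt_trivializationAt (by simpa using hq)] at h3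
  exact h3

theorem chartVec_chartChange {p q x : M} (hx : x ∈ (extChartAt (𝓡 n) q).source)
    (v : EuclideanSpace ℝ (Fin n)) : chartVec q x (chartChange p q x v) = chartVec p x v :=
  chartVec_chartCoord hx _

theorem continuousOn_chartChange (p q : M) :
    ContinuousOn (fun x : M ↦
      (chartChange p q x : EuclideanSpace ℝ (Fin n) →L[ℝ] EuclideanSpace ℝ (Fin n)))
      ((extChartAt (𝓡 n) p).source ∩ (extChartAt (𝓡 n) q).source) := by
  have h := continuousOn_coordChange ℝ
    (trivializationAt (EuclideanSpace ℝ (Fin n)) (TangentSpace (𝓡 n) : M → Type _) p)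
    (trivializationAt (EuclideanSpace ℝ (Fin n)) (TangentSpace (𝓡 n) : M → Type _) q)
  have hs : (extChartAt (𝓡 n) p).source ∩ (extChartAt (𝓡 n) q).source =
    (trivializationAt (EuclideanSpace ℝ (Fin n)) (TangentSpace (𝓡 n) : M → Type _) p).baseSet ∩
    (trivializationAt (EuclideanSpace ℝ (Fin n)) (TangentSpace (𝓡 n) : M → Type _) q).baseSet := by
    simp
  rw [hs]
  refine h.congr fun x hx ↦ ?_
  ext1 v
  rw [ContinuousLinearEquiv.coe_coe, Bundle.Trivialization.coordChangeL_apply _ _ hx]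
  have h1 : chartVec p x v = (trivializationAt (EuclideanSpace ℝ (Fin n))
      (TangentSpace (𝓡 n) : M → Type _) p).symm x v :=
    Bundle.Trivialization.symmL_apply _ hx.1 v
  rw [← h1]
  exact Bundle.Trivialization.continuousLinearMapAt_apply_of_mem (R := ℝ) _ hx.2 (chartVec p x v)

end Charts

/-! ### The metric and the Riemannian density in charts -/

section Metric

variable {n : ℕ} {M : Type*} [TopologicalSpace M]
  [ChartedSpace (EuclideanSpace ℝ (Fin n)) M] [IsManifold (𝓡 n) ∞ M]
  [RiemannianBundle (fun x : M ↦ TangentSpace (𝓡 n) x)]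

/-- The coefficients of the metric in the preferred chart at `p`. -/
noncomputable def gramEntry (p : M) (i j : Fin n) (y : EuclideanSpace ℝ (Fin n)) : ℝ :=
  inner ℝ
    (chartVec p ((extChartAt (𝓡 n) p).symm y) (EuclideanSpace.basisFun (Fin n) ℝ i))
    (chartVec p ((extChartAt (𝓡 n) p).symm y) (EuclideanSpace.basisFun (Fin n) ℝ j))

/-- The metric in the preferred chart at `p`. -/
noncomputable def metricRep (p : M) (y : EuclideanSpace ℝ (Fin n)) :
    EuclideanSpace ℝ (Fin n) →L[ℝ] EuclideanSpace ℝ (Fin n) →L[ℝ] ℝ :=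
  ∑ i, ∑ j, gramEntry p i j y •
    (EuclideanSpace.proj i : EuclideanSpace ℝ (Fin n) →L[ℝ] ℝ).smulRight
      (EuclideanSpace.proj j : EuclideanSpace ℝ (Fin n) →L[ℝ] ℝ)

theorem metricRep_apply (p : M) (y v w : EuclideanSpace ℝ (Fin n)) :
    metricRep p y v w = inner ℝ (chartVec p ((extChartAt (𝓡 n) p).symm y) v)
      (chartVec p ((extChartAt (𝓡 n) p).symm y) w) := by
  have h : ∀ v : EuclideanSpace ℝ (Fin n), v = ∑ i, v i • EuclideanSpace.basisFun (Fin n) ℝ i :=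
    fun v ↦ by
      have := (EuclideanSpace.basisFun (Fin n) ℝ).sum_repr v
      simpa using this.symm
  conv_rhs => rw [h v, h w]
  simp only [map_sum, map_smul, sum_inner, inner_sum, inner_smul_left, inner_smul_right]
  simp only [metricRep, _root_.sum_apply, _root_.smul_apply,
    ContinuousLinearMap.smulRight_apply, gramEntry, smul_eq_mul, Finset.mul_sum]
  rw [Finset.sum_comm]
  refine Finset.sum_congr rfl fun i _ ↦ Finset.sum_congr rfl fun j _ ↦ ?_
  simp
  ring

theorem metricRep_comm (p : M) (y v w : EuclideanSpace ℝ (Fin n)) :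
    metricRep p y v w = metricRep p y w v := by
  rw [metricRep_apply, metricRep_apply, real_inner_comm]

theorem metricRep_self_pos {p : M} {y v : EuclideanSpace ℝ (Fin n)}
    (hy : y ∈ (extChartAt (𝓡 n) p).target) (hv : v ≠ 0) : 0 < metricRep p y v v := by
  rw [metricRep_apply, real_inner_self_eq_norm_sq]
  have : chartVec p ((extChartAt (𝓡 n) p).symm y) v ≠ 0 := fun h ↦ hv <| by
    rw [← chartCoord_chartVec ((extChartAt (𝓡 n) p).map_target hy) v, h, map_zero]
  positivity

theorem inner_eq_metricRep (p : M) (X Y : SmoothVF n M) {y : EuclideanSpace ℝ (Fin n)}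
    (hy : y ∈ (extChartAt (𝓡 n) p).target) :
    inner ℝ (X ((extChartAt (𝓡 n) p).symm y)) (Y ((extChartAt (𝓡 n) p).symm y))
      = metricRep p y (localRep p X y) (localRep p Y y) := by
  have hx := (extChartAt (𝓡 n) p).map_target hy
  rw [metricRep_apply, localRep_eq p X hy, localRep_eq p Y hy, chartVec_chartCoord hx,
    chartVec_chartCoord hx]

theorem volCoeff_eq (o : ManifoldOrientation n M) {p x : M}
    (hx : x ∈ (extChartAt (𝓡 n) p).source) : volCoeff o p x =
      volForm o x fun i ↦ chartVec p x (EuclideanSpace.basisFun (Fin n) ℝ i) := by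
  rw [volCoeff]
  congr 1
  ext1 i
  exact (Bundle.Trivialization.symmL_apply _ (mem_baseSet hx) _).symm

theorem volForm_chartVec (o : ManifoldOrientation n M) {p x : M}
    (hx : x ∈ (extChartAt (𝓡 n) p).source) (v : Fin n → EuclideanSpace ℝ (Fin n)) :
    volForm o x (fun i ↦ chartVec p x (v i)) = volCoeff o p x * stdDet n v := by
  rw [volCoeff_eq o hx]
  exact AlternatingMap.eq_mul_stdDet
    ((volForm o x).compLinearMap (chartVec (n := n) p x).toLinearMap) v

/-- In an orthonormal basis the volume form is, up to sign, the determinant of the coordinate matrix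
A, and the Gram matrix is AᵀA. This expresses the density through the metric coefficients, whose
smoothness is known. -/
theorem sq_volumeForm_eq_det {V : Type*} [NormedAddCommGroup V] [InnerProductSpace ℝ V]
    [Fact (Module.finrank ℝ V = n)] (o : Orientation ℝ V (Fin n)) (v : Fin n → V) :
    o.volumeForm v ^ 2 = Matrix.det (Matrix.of fun i j ↦ inner ℝ (v i) (v j)) := by
  have hf : Module.finrank ℝ V = n := Fact.out
  -- For n = 0 the dimension hypothesis does not give finite dimensionality; there the volume form
  -- is ±1 on the empty family.
  rcases Nat.eq_zero_or_pos n with h0 | hn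
  · subst h0
    rcases o.eq_or_eq_neg_of_isEmpty with h | h <;> simp [h]
  have : FiniteDimensional ℝ V := FiniteDimensional.of_finrank_pos (by omega)
  let b : OrthonormalBasis (Fin n) ℝ V := (stdOrthonormalBasis ℝ V).reindex (finCongr hf)
  rw [← sq_abs, o.volumeForm_robust' b v, sq_abs, Module.Basis.det_apply]
  set A := b.toBasis.toMatrix v
  have h : (Matrix.of fun i j ↦ inner ℝ (v i) (v j)) = A.transpose * A := by
    ext i j
    rw [Matrix.mul_apply, Matrix.of_apply, ← b.sum_inner_mul_inner (v i) (v j)]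
    refine Finset.sum_congr rfl fun k _ ↦ ?_
    simp only [A, Matrix.transpose_apply, Module.Basis.toMatrix_apply,
      OrthonormalBasis.coe_toBasis_repr_apply, OrthonormalBasis.repr_apply_apply]
    rw [real_inner_comm (v i)]
  rw [h, Matrix.det_mul, Matrix.det_transpose, sq]

/-- The Riemannian density in the preferred chart at `p`. -/
noncomputable def density (o : ManifoldOrientation n M) (p : M)
    (y : EuclideanSpace ℝ (Fin n)) : ℝ := |volCoeff o p ((extChartAt (𝓡 n) p).symm y)|

theorem density_eq_sqrt (o : ManifoldOrientation n M) {p : M} {y : EuclideanSpace ℝ (Fin n)}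
    (hy : y ∈ (extChartAt (𝓡 n) p).target) :
    density o p y = √(Matrix.det (Matrix.of fun i j ↦ gramEntry p i j y)) := by
  rw [density, volCoeff_eq o ((extChartAt (𝓡 n) p).map_target hy), ← Real.sqrt_sq_eq_abs]
  congr 1
  exact sq_volumeForm_eq_det _ _

theorem volCoeff_chartChange (o : ManifoldOrientation n M) {p q x : M}
    (hp : x ∈ (extChartAt (𝓡 n) p).source) (hq : x ∈ (extChartAt (𝓡 n) q).source) :
    volCoeff o p x = LinearMap.det (chartChange (n := n) p q x).toLinearMap * volCoeff o q x := by
  have h := AlternatingMap.map_clm_apply_eq ((volForm o x).compLinearMap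
    (chartVec (n := n) q x).toLinearMap) (chartChange (n := n) p q x).toLinearMap
    (EuclideanSpace.basisFun (Fin n) ℝ)
  rw [volCoeff_eq o hp, volCoeff_eq o hq]
  refine Eq.trans ?_ h
  rw [AlternatingMap.compLinearMap_apply]
  congr 1
  ext1 i
  exact (chartVec_chartChange hq _).symm

/-- The frame of the tangent space at `x` given by the preferred chart at `p`. -/
noncomputable def chartBasis {p x : M} (hx : x ∈ (extChartAt (𝓡 n) p).source) :
    Module.Basis (Fin n) ℝ (TangentSpace (𝓡 n) x) :=
  (EuclideanSpace.basisFun (Fin n) ℝ).toBasis.map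
    ((trivializationAt (EuclideanSpace ℝ (Fin n)) (TangentSpace (𝓡 n) : M → Type _)
      p).continuousLinearEquivAt ℝ x (mem_baseSet hx)).symm.toLinearEquiv

theorem chartBasis_apply {p x : M} (hx : x ∈ (extChartAt (𝓡 n) p).source) (i : Fin n) :
    chartBasis hx i = chartVec p x (EuclideanSpace.basisFun (Fin n) ℝ i) := by
  rw [chartBasis, Module.Basis.map_apply]
  simp only [OrthonormalBasis.coe_toBasis]
  rw [chartVec, Bundle.Trivialization.symmL_apply _ (mem_baseSet hx)]
  rfl

/-- The volume form has absolute value 1 on an orthonormal basis, so it is a nonzero top form and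
does not vanish on the coordinate frame. -/
theorem density_pos (o : ManifoldOrientation n M) {p : M} {y : EuclideanSpace ℝ (Fin n)}
    (hy : y ∈ (extChartAt (𝓡 n) p).target) : 0 < density o p y := by
  rw [density, abs_pos, volCoeff_eq o ((extChartAt (𝓡 n) p).map_target hy)]
  simp_rw [← chartBasis_apply ((extChartAt (𝓡 n) p).map_target hy)]
  have hfd : FiniteDimensional ℝ (TangentSpace (𝓡 n) ((extChartAt (𝓡 n) p).symm y)) :=
    inferInstanceAs (FiniteDimensional ℝ (EuclideanSpace ℝ (Fin n)))
  refine AlternatingMap.map_basis_ne_zero_iff _ _ |>.2 ?_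
  intro h
  have := (o.at' ((extChartAt (𝓡 n) p).symm y)).abs_volumeForm_apply_of_orthonormal
    ((stdOrthonormalBasis ℝ _).reindex (finCongr Fact.out))
  rw [volForm] at h
  rw [h, AlternatingMap.zero_apply, abs_zero] at this
  exact zero_ne_one this

theorem volCoeff_pos_iff (o : ManifoldOrientation n M) (hn : 0 < n) {p x : M}
    (hx : x ∈ (extChartAt (𝓡 n) p).source) : 0 < volCoeff o p x ↔
      Orientation.map (Fin n) ((trivializationAt (EuclideanSpace ℝ (Fin n))
        (TangentSpace (𝓡 n) : M → Type _) p).continuousLinearEquivAt ℝ x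
          (mem_baseSet hx)).toLinearEquiv (o.at' x)
      = (EuclideanSpace.basisFun (Fin n) ℝ).toBasis.orientation := by
  have hv := (o.at' x).volumeForm_robust ((o.at' x).finOrthonormalBasis hn Fact.out)
    ((o.at' x).finOrthonormalBasis_orientation hn Fact.out)
  rw [volCoeff_eq o hx]
  simp_rw [← chartBasis_apply hx]
  rw [volForm, hv, ← Module.Basis.orientation_eq_iff_det_pos,
    (o.at' x).finOrthonormalBasis_orientation hn Fact.out]
  rw [chartBasis, Module.Basis.orientation_map]
  rw [ContinuousLinearEquiv.toLinearEquiv_symm]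
  rw [← Orientation.map_symm, Equiv.eq_symm_apply]

theorem eventually_volCoeff_eq_self (o : ManifoldOrientation n M) (hn : 0 < n) (p : M) :
    ∃ s : ℝ, s ≠ 0 ∧ ∀ᶠ x in 𝓝 p, 0 < s * volCoeff o p x := by
  obtain ⟨w, hw⟩ := o.locallyConstant p
  have hs := (isOpen_extChartAt_source (I := 𝓡 n) p).mem_nhds (mem_extChartAt_source p)
  by_cases h : w = (EuclideanSpace.basisFun (Fin n) ℝ).toBasis.orientation
  · refine ⟨1, one_ne_zero, ?_⟩
    filter_upwards [hw, hs] with x hx hxs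
    rw [one_mul, volCoeff_pos_iff o hn hxs, ← h]
    exact hx _
  · refine ⟨-1, by norm_num, ?_⟩
    filter_upwards [hw, hs] with x hx hxs
    have h1 : ¬ 0 < volCoeff o p x := by
      rw [volCoeff_pos_iff o hn hxs, hx (mem_baseSet hxs)]
      exact h
    have h2 : 0 < density o p (extChartAt (𝓡 n) p x) :=
      density_pos o ((extChartAt (𝓡 n) p).map_source hxs)
    rw [density, (extChartAt (𝓡 n) p).left_inv hxs, abs_pos] at h2
    have := lt_of_le_of_ne (not_lt.1 h1) h2
    linarith

/-- The Lie derivative differentiates the signed coefficient of μ, whereas the measure uses its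
absolute value; both give the same divergence once the sign is locally constant. An orientation is
assumed locally constant only in the chart centred at each point, so the chart at p is compared near
x with the chart at x. The determinant of the transition map is continuous and nonzero there, so it
keeps its sign. -/
theorem eventually_volCoeff_eq (o : ManifoldOrientation n M) (hn : 0 < n) {p : M}
    {y : EuclideanSpace ℝ (Fin n)} (hy : y ∈ (extChartAt (𝓡 n) p).target) :
    ∃ s : ℝ, ∀ᶠ z in 𝓝 y, volCoeff o p ((extChartAt (𝓡 n) p).symm z) = s * density o p z := by
  set x := (extChartAt (𝓡 n) p).symm y
  have hx : x ∈ (extChartAt (𝓡 n) p).source := (extChartAt (𝓡 n) p).map_target hy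
  obtain ⟨s, hs0, hs⟩ := eventually_volCoeff_eq_self o hn x
  set D : M → ℝ := fun z ↦ LinearMap.det (chartChange (n := n) p x z).toLinearMap
  have hO : IsOpen ((extChartAt (𝓡 n) p).source ∩ (extChartAt (𝓡 n) x).source) :=
    (isOpen_extChartAt_source p).inter (isOpen_extChartAt_source x)
  have hOx : (extChartAt (𝓡 n) p).source ∩ (extChartAt (𝓡 n) x).source ∈ 𝓝 x :=
    hO.mem_nhds ⟨hx, mem_extChartAt_source x⟩
  have hD : ContinuousAt D x :=
    (ContinuousLinearMap.continuous_det.continuousAt).comp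
      ((continuousOn_chartChange (n := n) p x).continuousAt hOx)
  have hD0 : D x ≠ 0 := fun h ↦ by
    have h2 : 0 < density o p y := density_pos o hy
    rw [density, volCoeff_chartChange o hx (mem_extChartAt_source x), abs_pos] at h2
    exact h2 (by rw [show LinearMap.det (chartChange (n := n) p x x).toLinearMap = 0 from h, zero_mul])
  have hsign : ∀ᶠ z in 𝓝 x, 0 < D x * D z := by
    have : ContinuousAt (fun z ↦ D x * D z) x := hD.const_mul _
    exact this.eventually (lt_mem_nhds (mul_self_pos.2 hD0))
  have hc : ContinuousAt (extChartAt (𝓡 n) p).symm y :=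
    continuousAt_extChartAt_symm'' hy
  have key : ∀ᶠ z in 𝓝 x, 0 < (s * D x) * volCoeff o p z := by
    filter_upwards [hs, hsign, hOx] with z h1 h2 h3
    rw [volCoeff_chartChange o h3.1 h3.2]
    have := mul_pos h1 h2
    calc 0 < _ := this
      _ = _ := by ring
  -- The factor `s` carries the sign in the chart at `x`, and `D x` the sign of the transition from
  -- the chart at `p`.
  refine ⟨SignType.sign (s * D x), ?_⟩
  filter_upwards [hc.eventually key] with z hz
  rw [density]
  rcases lt_or_gt_of_ne (mul_ne_zero hs0 hD0) with h | h
  · rw [sign_neg h, abs_of_neg (neg_of_mul_pos_right hz h.le)]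
    simp
  · rw [sign_pos h, abs_of_pos ((mul_pos_iff_of_pos_left h).1 hz)]
    simp

theorem density_chartChange (o : ManifoldOrientation n M) {p q : M}
    {y : EuclideanSpace ℝ (Fin n)} (hy : y ∈ (extChartAt (𝓡 n) p).target)
    (hq : (extChartAt (𝓡 n) p).symm y ∈ (extChartAt (𝓡 n) q).source) :
    density o p y = |(chartChange (n := n) p q ((extChartAt (𝓡 n) p).symm y)).det| *
      density o q (extChartAt (𝓡 n) q ((extChartAt (𝓡 n) p).symm y)) := by
  rw [density, volCoeff_chartChange o ((extChartAt (𝓡 n) p).map_target hy) hq, abs_mul,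
    density, (extChartAt (𝓡 n) q).left_inv hq]

variable [IsContMDiffRiemannianBundle (𝓡 n) ∞ (EuclideanSpace ℝ (Fin n))
      (fun x : M ↦ TangentSpace (𝓡 n) x)]

theorem contDiffAt_gramEntry {p : M} {y : EuclideanSpace ℝ (Fin n)}
    (hy : y ∈ (extChartAt (𝓡 n) p).target) (i j : Fin n) :
    ContDiffAt ℝ ∞ (gramEntry p i j) y := by
  have hx := (extChartAt (𝓡 n) p).map_target hy
  have h := ContMDiffAt.inner_bundle (IB := 𝓡 n) (n := ∞) (F := EuclideanSpace ℝ (Fin n))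
    (E := fun x : M ↦ TangentSpace (𝓡 n) x) (IM := 𝓡 n) (b := fun x : M ↦ x)
    (contMDiffAt_chartVec hx
      (contMDiffAt_const (c := (EuclideanSpace.basisFun (Fin n) ℝ i))))
    (contMDiffAt_chartVec hx
      (contMDiffAt_const (c := (EuclideanSpace.basisFun (Fin n) ℝ j))))
  have h2 : ContMDiffAt 𝓘(ℝ, EuclideanSpace ℝ (Fin n)) (𝓡 n) ∞ (extChartAt (𝓡 n) p).symm y :=
    (contMDiffOn_extChartAt_symm p).contMDiffAt
      ((isOpen_extChartAt_target p).mem_nhds hy)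
  exact (h.comp y h2).contDiffAt

theorem contDiffAt_metricRep {p : M} {y : EuclideanSpace ℝ (Fin n)}
    (hy : y ∈ (extChartAt (𝓡 n) p).target) : ContDiffAt ℝ ∞ (metricRep p) y :=
  contDiffAt_sum_smul_smulRight (contDiffAt_gramEntry hy)

theorem contDiffAt_density (o : ManifoldOrientation n M) {p : M}
    {y : EuclideanSpace ℝ (Fin n)} (hy : y ∈ (extChartAt (𝓡 n) p).target) :
    ContDiffAt ℝ ∞ (density o p) y := by
  have he : density o p =ᶠ[𝓝 y]
      fun y ↦ √(Matrix.det (Matrix.of fun i j ↦ gramEntry p i j y)) := by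
    filter_upwards [(isOpen_extChartAt_target p).mem_nhds hy] with z hz
    exact density_eq_sqrt o hz
  refine ContDiffAt.congr_of_eventuallyEq (ContDiffAt.sqrt ?_ ?_) he
  · simp only [Matrix.det_apply]
    refine ContDiffAt.sum fun σ _ ↦ ContDiffAt.const_smul _ (contDiffAt_prod fun i _ ↦ ?_)
    exact contDiffAt_gramEntry hy _ _
  · intro h0
    have := density_pos o hy
    rw [density_eq_sqrt o hy, h0, Real.sqrt_zero] at this
    exact lt_irrefl _ this

end Metric

theorem exists_smooth_bump {E : Type*} [NormedAddCommGroup E] [NormedSpace ℝ E]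
    [FiniteDimensional ℝ E] {q : E} {U : Set E} (hU : U ∈ 𝓝 q) :
    ∃ χ : E → ℝ, ContDiff ℝ ∞ χ ∧ HasCompactSupport χ ∧ tsupport χ ⊆ U ∧ χ =ᶠ[𝓝 q] 1 := by
  obtain ⟨ε, hε, h⟩ := Metric.nhds_basis_closedBall.mem_iff.1 hU
  let f : ContDiffBump q := ⟨ε / 2, ε, half_pos hε, half_lt_self hε⟩
  exact ⟨f, f.contDiff, f.hasCompactSupport, by rw [f.tsupport_eq]; exact h, f.eventuallyEq_one⟩

/-! ### The divergence of vector fields -/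

section Divergence

variable {n : ℕ} {M : Type*} [TopologicalSpace M]
  [ChartedSpace (EuclideanSpace ℝ (Fin n)) M] [IsManifold (𝓡 n) ∞ M]

theorem mvfderiv_eq_of_eventuallyEq {p x : M} {f : M → ℝ} {g : EuclideanSpace ℝ (Fin n) → ℝ}
    (hx : x ∈ (extChartAt (𝓡 n) p).source) (hg : DifferentiableAt ℝ g (extChartAt (𝓡 n) p x))
    (hf : f =ᶠ[𝓝 x] g ∘ extChartAt (𝓡 n) p) (v : TangentSpace (𝓡 n) x) :
    mvfderiv (𝓡 n) f x v = fderiv ℝ g (extChartAt (𝓡 n) p x) (chartCoord p x v) := by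
  have : IsManifold (𝓡 n) 1 M := IsManifold.of_le (n := ∞) (by simp)
  have h1 : HasMFDerivAt (𝓡 n) 𝓘(ℝ, EuclideanSpace ℝ (Fin n)) (extChartAt (𝓡 n) p) x
      (chartCoord p x) := by
    have := (mdifferentiableAt_extChartAt (I := 𝓡 n) (x := p) (y := x)
      (by simpa using hx)).hasMFDerivAt
    rw [← TangentBundle.continuousLinearMapAt_trivializationAt (by simpa using hx)] at this
    exact this
  have h2 := (hg.hasFDerivAt.hasMFDerivAt.comp x h1).congr_of_eventuallyEq hf
  rw [mvfderiv, h2.mfderiv]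
  rfl

theorem localRep_add_eventuallyEq (p : M) (X Y : SmoothVF n M) {y : EuclideanSpace ℝ (Fin n)}
    (hy : y ∈ (extChartAt (𝓡 n) p).target) :
    localRep p (X + Y) =ᶠ[𝓝 y] localRep p X + localRep p Y := by
  filter_upwards [(isOpen_extChartAt_target p).mem_nhds hy] with z hz
  exact localRep_add p X Y hz

theorem localRep_smul_eventuallyEq (p : M) (c : ℝ) (X : SmoothVF n M)
    {y : EuclideanSpace ℝ (Fin n)} (hy : y ∈ (extChartAt (𝓡 n) p).target) :
    localRep p (c • X) =ᶠ[𝓝 y] c • localRep p X := by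
  filter_upwards [(isOpen_extChartAt_target p).mem_nhds hy] with z hz
  exact localRep_smul p c X hz

theorem exists_smoothVF_apply_eq [T2Space M] (x : M) (v : TangentSpace (𝓡 n) x) :
    ∃ X : SmoothVF n M, X x = v := by
  have hx := mem_extChartAt_source (I := 𝓡 n) x
  obtain ⟨χ, h1, h2, h3, h4⟩ := exists_smooth_bump
    ((isOpen_extChartAt_target (I := 𝓡 n) x).mem_nhds (mem_extChartAt_target x))
  refine ⟨ofChart x (fun y ↦ χ y • chartCoord x x v) (h1.smul contDiff_const)
    (h2.smul_right) ((tsupport_smul_subset_left _ _).trans h3), ?_⟩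
  rw [ofChart_apply hx, h4.eq_of_nhds, Pi.one_apply, one_smul, chartVec_chartCoord hx]

variable [RiemannianBundle (fun x : M ↦ TangentSpace (𝓡 n) x)]

/-- The divergence of a vector field, as a function in the preferred chart at `p`. -/
noncomputable def chartDiv (o : ManifoldOrientation n M) (p : M) (X : SmoothVF n M) :
    EuclideanSpace ℝ (Fin n) → ℝ :=
  wDiv (density o p) (localRep p X)

/-- The divergence of a vector field. -/
noncomputable def divVF (o : ManifoldOrientation n M) (X : SmoothVF n M) (x : M) : ℝ :=
  chartDiv o x X (extChartAt (𝓡 n) x x)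

variable [IsContMDiffRiemannianBundle (𝓡 n) ∞ (EuclideanSpace ℝ (Fin n))
      (fun x : M ↦ TangentSpace (𝓡 n) x)]

/-- This is L_X μ = (div X) μ. Locally μ is ± the density times the determinant. By the Leibniz rule
the derivatives of the Vᵢ cancel against half of each bracket [X, Vᵢ]; the other half sums to the
trace of DX by `stdDet_sum_update`, and the derivative of the density supplies the remaining term.
-/
theorem lieDerivVolForm_eq (o : ManifoldOrientation n M) (hn : 0 < n) (X : SmoothVF n M)
    (V : Fin n → SmoothVF n M) {p x : M} (hx : x ∈ (extChartAt (𝓡 n) p).source) :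
    lieDerivVolForm o X V x
      = chartDiv o p X (extChartAt (𝓡 n) p x) * volForm o x fun i ↦ V i x := by
  set y := extChartAt (𝓡 n) p x with hyx
  have hy : y ∈ (extChartAt (𝓡 n) p).target := (extChartAt (𝓡 n) p).map_source hx
  have hyx' : (extChartAt (𝓡 n) p).symm y = x := (extChartAt (𝓡 n) p).left_inv hx
  obtain ⟨s, hs⟩ := eventually_volCoeff_eq o hn hy
  set ρ := density o p with hρ
  have hv : ∀ i, HasFDerivAt (localRep p (V i)) (fderiv ℝ (localRep p (V i)) y) y := fun i ↦
    ((localRep_contDiffAt p (V i) hy).differentiableAt (by simp)).hasFDerivAt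
  obtain ⟨D, hD, hDw⟩ := hasFDerivAt_stdDet hv
  have hρd : HasFDerivAt ρ (fderiv ℝ ρ y) y :=
    ((contDiffAt_density o hy).differentiableAt (by simp)).hasFDerivAt
  have hg := (hρd.mul hD).const_mul s
  have hvc : volCoeff o p x = s * ρ y := by
    have := hs.self_of_nhds
    rwa [hyx'] at this
  have he : (fun z ↦ volForm o z fun i ↦ V i z) =ᶠ[𝓝 x]
      (fun z ↦ s * (ρ z * stdDet n fun i ↦ localRep p (V i) z)) ∘ extChartAt (𝓡 n) p := by
    filter_upwards [(isOpen_extChartAt_source p).mem_nhds hx,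
      (continuousAt_extChartAt' hx).eventually hs] with z hz hzs
    rw [(extChartAt (𝓡 n) p).left_inv hz] at hzs
    simp_rw [← chartVec_localRep (V _) hz]
    rw [volForm_chartVec o hz, hzs, Function.comp_apply]
    ring
  have h1 := mvfderiv_eq_of_eventuallyEq hx hg.differentiableAt he (X x)
  rw [← localRep_extChartAt X hx, ← hyx] at h1
  rw [lieDerivVolForm, h1, hg.fderiv]
  have h2 : ∀ i, volForm o x (Function.update (fun j ↦ V j x) i (⁅X, V i⁆ x)) =
      s * ρ y * (stdDet n (Function.update (fun j ↦ localRep p (V j) y) i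
          (fderiv ℝ (localRep p (V i)) y (localRep p X y))) -
        stdDet n (Function.update (fun j ↦ localRep p (V j) y) i
          (fderiv ℝ (localRep p X) y (localRep p (V i) y)))) := by
    intro i
    have : Function.update (fun j ↦ V j x) i (⁅X, V i⁆ x) = fun j ↦ chartVec p x
        (Function.update (fun j ↦ localRep p (V j) y) i (localRep p ⁅X, V i⁆ y) j) := by
      ext1 j
      rcases eq_or_ne j i with rfl | hj
      · rw [Function.update_self, Function.update_self, hyx, chartVec_localRep _ hx]
      · rw [Function.update_of_ne hj, Function.update_of_ne hj, hyx, chartVec_localRep _ hx]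
    rw [this, volForm_chartVec o hx, hvc, localRep_lie p _ _ hy, VectorField.lieBracket,
      AlternatingMap.map_update_sub]
  have h3 : volForm o x (fun i ↦ V i x) = s * ρ y * stdDet n fun i ↦ localRep p (V i) y := by
    simp_rw [← chartVec_localRep (V _) hx]
    rw [volForm_chartVec o hx, hvc]
  have h4 := stdDet_sum_update (fderiv ℝ (localRep p X) y) fun i ↦ localRep p (V i) y
  have hρ0 : ρ y ≠ 0 := (density_pos o hy).ne'
  simp only [h2]
  rw [← Finset.mul_sum, Finset.sum_sub_distrib, h4, h3, chartDiv, wDiv, eDiv, ← hρ]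
  simp only [_root_.smul_apply, _root_.add_apply, smul_eq_mul, hDw]
  field_simp
  ring

/-- Independence of the chart comes for free: in every chart the divergence is the factor relating
the intrinsic L_X μ to μ, and μ is nonzero on fields extending a basis at x. -/
theorem divVF_eq [T2Space M] (o : ManifoldOrientation n M) (hn : 0 < n) (X : SmoothVF n M)
    {p x : M} (hx : x ∈ (extChartAt (𝓡 n) p).source) :
    divVF o X x = chartDiv o p X (extChartAt (𝓡 n) p x) := by
  choose V hV using fun i ↦ exists_smoothVF_apply_eq (n := n) x
    (chartVec p x (EuclideanSpace.basisFun (Fin n) ℝ i))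
  have h0 : volForm o x (fun i ↦ V i x) ≠ 0 := by
    simp_rw [hV]
    rw [← volCoeff_eq o hx]
    have := density_pos o ((extChartAt (𝓡 n) p).map_source hx)
    rw [density, (extChartAt (𝓡 n) p).left_inv hx] at this
    exact abs_pos.1 this
  refine mul_right_cancel₀ h0 ?_
  rw [← lieDerivVolForm_eq o hn X V hx, divVF,
    ← lieDerivVolForm_eq o hn X V (mem_extChartAt_source x)]

theorem divVF_symm_eq [T2Space M] (o : ManifoldOrientation n M) (hn : 0 < n) (X : SmoothVF n M)
    {p : M} {y : EuclideanSpace ℝ (Fin n)} (hy : y ∈ (extChartAt (𝓡 n) p).target) :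
    divVF o X ((extChartAt (𝓡 n) p).symm y) = chartDiv o p X y := by
  rw [divVF_eq o hn X ((extChartAt (𝓡 n) p).map_target hy), (extChartAt (𝓡 n) p).right_inv hy]

theorem mem_divergenceFree_iff [T2Space M] (o : ManifoldOrientation n M) (hn : 0 < n)
    (X : SmoothVF n M) : X ∈ divergenceFree o ↔ ∀ x, divVF o X x = 0 := by
  refine ⟨fun h x ↦ ?_, fun h V x ↦ ?_⟩
  · choose V hV using fun i ↦ exists_smoothVF_apply_eq (n := n) x
      (chartVec x x (EuclideanSpace.basisFun (Fin n) ℝ i))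
    have h0 : volForm o x (fun i ↦ V i x) ≠ 0 := by
      simp_rw [hV]
      rw [← volCoeff_eq o (mem_extChartAt_source x)]
      have := density_pos o (mem_extChartAt_target (I := 𝓡 n) x)
      rw [density, (extChartAt (𝓡 n) x).left_inv (mem_extChartAt_source x)] at this
      exact abs_pos.1 this
    have h1 := h V x
    rw [lieDerivVolForm_eq o hn X V (mem_extChartAt_source x)] at h1
    exact (mul_eq_zero.1 h1).resolve_right h0
  · rw [lieDerivVolForm_eq o hn X V (mem_extChartAt_source x)]
    have := h x
    rw [divVF] at this
    rw [this, zero_mul]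

theorem divVF_add (o : ManifoldOrientation n M) (X Y : SmoothVF n M) (x : M) :
    divVF o (X + Y) x = divVF o X x + divVF o Y x := by
  have hy := mem_extChartAt_target (I := 𝓡 n) x
  rw [divVF, chartDiv, wDiv_congr (localRep_add_eventuallyEq x X Y hy),
    wDiv_add ((localRep_contDiffAt x X hy).differentiableAt (by simp))
      ((localRep_contDiffAt x Y hy).differentiableAt (by simp))]
  rfl

theorem divVF_smul (o : ManifoldOrientation n M) (c : ℝ) (X : SmoothVF n M) (x : M) :
    divVF o (c • X) x = c * divVF o X x := by
  have hy := mem_extChartAt_target (I := 𝓡 n) x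
  rw [divVF, chartDiv, wDiv_congr (localRep_smul_eventuallyEq x c X hy),
    wDiv_const_smul c ((localRep_contDiffAt x X hy).differentiableAt (by simp))]
  rfl

theorem divVF_sub (o : ManifoldOrientation n M) (X Y : SmoothVF n M) (x : M) :
    divVF o (X - Y) x = divVF o X x - divVF o Y x := by
  have : X - Y = X + (-1 : ℝ) • Y := by rw [neg_one_smul, sub_eq_add_neg]
  rw [this, divVF_add, divVF_smul]
  ring

theorem contDiffAt_chartDiv (o : ManifoldOrientation n M) {p : M} (X : SmoothVF n M)
    {y : EuclideanSpace ℝ (Fin n)} (hy : y ∈ (extChartAt (𝓡 n) p).target) :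
    ContDiffAt ℝ ∞ (chartDiv o p X) y :=
  contDiffAt_wDiv (contDiffAt_density o hy) (density_pos o hy).ne' (localRep_contDiffAt p X hy)

theorem chartDiv_lie (o : ManifoldOrientation n M) {p : M} (X Y : SmoothVF n M)
    {y : EuclideanSpace ℝ (Fin n)} (hy : y ∈ (extChartAt (𝓡 n) p).target) :
    chartDiv o p ⁅X, Y⁆ y = fderiv ℝ (chartDiv o p Y) y (localRep p X y)
      - fderiv ℝ (chartDiv o p X) y (localRep p Y y) := by
  have he : localRep p ⁅X, Y⁆ =ᶠ[𝓝 y]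
      VectorField.lieBracket ℝ (localRep p X) (localRep p Y) := by
    filter_upwards [(isOpen_extChartAt_target p).mem_nhds hy] with z hz
    exact localRep_lie p X Y hz
  rw [chartDiv, wDiv_congr he, wDiv_lieBracket ((contDiffAt_density o hy).of_le two_le_infty)
    (density_pos o hy) ((localRep_contDiffAt p X hy).of_le two_le_infty)
    ((localRep_contDiffAt p Y hy).of_le two_le_infty)]
  rfl

theorem continuous_divVF [T2Space M] (o : ManifoldOrientation n M) (hn : 0 < n)
    (X : SmoothVF n M) : Continuous (divVF o X) := by
  refine continuous_iff_continuousAt.2 fun x ↦ ?_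
  have h : divVF o X =ᶠ[𝓝 x] chartDiv o x X ∘ extChartAt (𝓡 n) x := by
    filter_upwards [extChartAt_source_mem_nhds (I := 𝓡 n) x] with z hz
    exact divVF_eq o hn X hz
  exact ContinuousAt.congr ((contDiffAt_chartDiv o X (mem_extChartAt_target x)).continuousAt.comp
    (continuousAt_extChartAt x)) h.symm

end Divergence

/-! ### The Riemannian measure in charts -/

section Measure

variable {n : ℕ} {M : Type*} [TopologicalSpace M]
  [ChartedSpace (EuclideanSpace ℝ (Fin n)) M] [IsManifold (𝓡 n) ∞ M]

theorem tsupport_chartPartition_subset [T2Space M] [CompactSpace M] (p : M) :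
    tsupport (chartPartition n M p) ⊆ (extChartAt (𝓡 n) p).source := by
  have := (SmoothPartitionOfUnity.exists_isSubordinate_chartAt_source (𝓡 n) M).choose_spec p
  rwa [extChartAt_source]

theorem finite_chartPartition_ne_zero [T2Space M] [CompactSpace M] :
    {p : M | ∃ x, chartPartition n M p x ≠ 0}.Finite := by
  refine (LocallyFinite.finite_nonempty_of_compact (chartPartition n M).locallyFinite).subset ?_
  rintro p ⟨x, hx⟩
  exact ⟨x, hx⟩

theorem sum_chartPartition [T2Space M] [CompactSpace M] (x : M) :
    ∑ p ∈ (finite_chartPartition_ne_zero (n := n) (M := M)).toFinset,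
      chartPartition n M p x = 1 := by
  rw [← (chartPartition n M).sum_eq_one (mem_univ x), finsum_eq_sum_of_support_subset]
  intro p hp
  simpa using ⟨x, hp⟩

variable [MeasurableSpace M] [BorelSpace M]

theorem measurableSet_target_inter_preimage (q : M) {A : Set M} (hA : MeasurableSet A) :
    MeasurableSet ((extChartAt (𝓡 n) q).target ∩ (extChartAt (𝓡 n) q).symm ⁻¹' A) := by
  have hT := (isOpen_extChartAt_target (I := 𝓡 n) q).measurableSet
  have h1 : Measurable ((extChartAt (𝓡 n) q).target.domRestrict (extChartAt (𝓡 n) q).symm) :=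
    (continuousOn_extChartAt_symm q).domRestrict.measurable
  have h2 := hT.subtype_image (h1 hA)
  convert h2 using 1
  ext y
  exact ⟨fun h ↦ ⟨⟨y, h.1⟩, h.2, rfl⟩, fun ⟨z, hz, hzy⟩ ↦ hzy ▸ ⟨z.2, hz⟩⟩

theorem aemeasurable_extChartAt_symm (q : M) :
    AEMeasurable (extChartAt (𝓡 n) q).symm (volume.restrict (extChartAt (𝓡 n) q).target) :=
  (continuousOn_extChartAt_symm q).aemeasurable
    (isOpen_extChartAt_target (I := 𝓡 n) q).measurableSet

theorem map_extChartAt_symm_apply (q : M) (f : EuclideanSpace ℝ (Fin n) → ENNReal) {A : Set M}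
    (hA : MeasurableSet A) :
    (((volume.restrict (extChartAt (𝓡 n) q).target).withDensity f).map
      (extChartAt (𝓡 n) q).symm) A =
      ∫⁻ y in (extChartAt (𝓡 n) q).target ∩ (extChartAt (𝓡 n) q).symm ⁻¹' A, f y := by
  have hm := (aemeasurable_extChartAt_symm (n := n) q).mono_ac
    (withDensity_absolutelyContinuous _ f)
  rw [Measure.map_apply_of_aemeasurable hm hA, withDensity_apply' , Measure.restrict_restrict']
  · rw [inter_comm]
  · exact (isOpen_extChartAt_target (I := 𝓡 n) q).measurableSet

variable [T2Space M] [CompactSpace M]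
  [RiemannianBundle (fun x : M ↦ TangentSpace (𝓡 n) x)]

/-- The density transforms with the absolute Jacobian of the transition map, which is exactly the
factor in the change of variables formula. -/
theorem lintegral_chart_change (o : ManifoldOrientation n M) (p q : M) {A : Set M}
    (hA : MeasurableSet A) (f : M → ℝ) :
    ∫⁻ y in (extChartAt (𝓡 n) p).target ∩
        (extChartAt (𝓡 n) p).symm ⁻¹' (A ∩ (extChartAt (𝓡 n) q).source),
      ENNReal.ofReal (f ((extChartAt (𝓡 n) p).symm y) * density o p y) =
    ∫⁻ y in (extChartAt (𝓡 n) q).target ∩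
        (extChartAt (𝓡 n) q).symm ⁻¹' (A ∩ (extChartAt (𝓡 n) p).source),
      ENNReal.ofReal (f ((extChartAt (𝓡 n) q).symm y) * density o q y) := by
  set W := (extChartAt (𝓡 n) q).target ∩
        (extChartAt (𝓡 n) q).symm ⁻¹' (A ∩ (extChartAt (𝓡 n) p).source) with hW
  have hWm : MeasurableSet W := measurableSet_target_inter_preimage q
    (hA.inter (isOpen_extChartAt_source (I := 𝓡 n) p).measurableSet)
  have him : (extChartAt (𝓡 n) p ∘ (extChartAt (𝓡 n) q).symm) '' W =
      (extChartAt (𝓡 n) p).target ∩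
        (extChartAt (𝓡 n) p).symm ⁻¹' (A ∩ (extChartAt (𝓡 n) q).source) := by
    ext y
    constructor
    · rintro ⟨z, ⟨hz, hzA, hzp⟩, rfl⟩
      refine ⟨(extChartAt (𝓡 n) p).map_source hzp, ?_, ?_⟩
      · simpa only [Function.comp_apply, (extChartAt (𝓡 n) p).left_inv hzp] using hzA
      · simpa only [Function.comp_apply, (extChartAt (𝓡 n) p).left_inv hzp] using
          (extChartAt (𝓡 n) q).map_target hz
    · rintro ⟨hy, hyA, hyq⟩
      refine ⟨extChartAt (𝓡 n) q ((extChartAt (𝓡 n) p).symm y),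
        ⟨(extChartAt (𝓡 n) q).map_source hyq, ?_, ?_⟩, ?_⟩
      · simpa only [mem_preimage, (extChartAt (𝓡 n) q).left_inv hyq] using hyA
      · simpa only [mem_preimage, (extChartAt (𝓡 n) q).left_inv hyq] using
          (extChartAt (𝓡 n) p).map_target hy
      · rw [Function.comp_apply, (extChartAt (𝓡 n) q).left_inv hyq,
          (extChartAt (𝓡 n) p).right_inv hy]
  have hinj : InjOn (extChartAt (𝓡 n) p ∘ (extChartAt (𝓡 n) q).symm) W :=
    (extChartAt (𝓡 n) p).injOn.comp ((extChartAt (𝓡 n) q).symm.injOn.mono inter_subset_left)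
      fun z hz ↦ hz.2.2
  rw [← him, lintegral_image_eq_lintegral_abs_det_fderiv_mul volume hWm
    (fun z hz ↦ (hasFDerivAt_chart_change hz.1 hz.2.2).hasFDerivWithinAt) hinj]
  refine setLIntegral_congr_fun hWm fun z hz ↦ ?_
  simp only [Function.comp_apply]
  rw [(extChartAt (𝓡 n) p).left_inv hz.2.2, ← ENNReal.ofReal_mul (abs_nonneg _),
    density_chartChange o hz.1 hz.2.2]
  congr 1
  ring

theorem volMeasure_summand_apply (o : ManifoldOrientation n M) (p q : M) {A : Set M}
    (hA : MeasurableSet A) :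
    (((volume.restrict (extChartAt (𝓡 n) p).target).withDensity fun y ↦
      ENNReal.ofReal (chartPartition n M p ((extChartAt (𝓡 n) p).symm y) *
        |volCoeff o p ((extChartAt (𝓡 n) p).symm y)|)).map (extChartAt (𝓡 n) p).symm)
          (A ∩ (extChartAt (𝓡 n) q).source) =
    ∫⁻ y in (extChartAt (𝓡 n) q).target ∩ (extChartAt (𝓡 n) q).symm ⁻¹' A,
      ENNReal.ofReal (chartPartition n M p ((extChartAt (𝓡 n) q).symm y) * density o q y) := by
  have hS := (isOpen_extChartAt_source (I := 𝓡 n) q).measurableSet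
  have hSp := (isOpen_extChartAt_source (I := 𝓡 n) p).measurableSet
  rw [map_extChartAt_symm_apply p _ (hA.inter hS)]
  refine (lintegral_chart_change o p q hA (chartPartition n M p)).trans ?_
  -- The part of the chart at `q` outside the domain of the chart at `p` contributes nothing, since
  -- the partition function of `p` vanishes there.
  rw [← lintegral_inter_add_sdiff _ ((extChartAt (𝓡 n) q).target ∩
    (extChartAt (𝓡 n) q).symm ⁻¹' A) (measurableSet_target_inter_preimage q hSp)]
  have h0 : ∫⁻ y in ((extChartAt (𝓡 n) q).target ∩ (extChartAt (𝓡 n) q).symm ⁻¹' A) \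
      ((extChartAt (𝓡 n) q).target ∩ (extChartAt (𝓡 n) q).symm ⁻¹' (extChartAt (𝓡 n) p).source),
      ENNReal.ofReal (chartPartition n M p ((extChartAt (𝓡 n) q).symm y) * density o q y) = 0 := by
    rw [setLIntegral_congr_fun (g := fun _ ↦ 0) ((measurableSet_target_inter_preimage q hA).diff
      (measurableSet_target_inter_preimage q hSp)), lintegral_zero]
    intro y hy
    have : (extChartAt (𝓡 n) q).symm y ∉ tsupport (chartPartition n M p) := fun h ↦
      hy.2 ⟨hy.1.1, tsupport_chartPartition_subset p h⟩
    simp only [image_eq_zero_of_notMem_tsupport this, zero_mul, ENNReal.ofReal_zero]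
  rw [h0, add_zero]
  congr 2
  ext y
  simp only [mem_inter_iff, mem_preimage]
  tauto

variable [IsContMDiffRiemannianBundle (𝓡 n) ∞ (EuclideanSpace ℝ (Fin n))
      (fun x : M ↦ TangentSpace (𝓡 n) x)]

theorem density_nonneg (o : ManifoldOrientation n M) (q : M) (y : EuclideanSpace ℝ (Fin n)) :
    0 ≤ density o q y := abs_nonneg _

theorem continuousOn_density (o : ManifoldOrientation n M) (q : M) :
    ContinuousOn (density o q) (extChartAt (𝓡 n) q).target := fun _ hy ↦
  (contDiffAt_density o hy).continuousAt.continuousWithinAt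

/-- Once every summand is moved to the chart at q, the partition functions add up to 1. This removes
the partition of unity from all later integrals over one chart. -/
theorem volMeasure_restrict_eq (o : ManifoldOrientation n M) (q : M) :
    (volMeasure o).restrict (extChartAt (𝓡 n) q).source =
      ((volume.restrict (extChartAt (𝓡 n) q).target).withDensity fun y ↦
        ENNReal.ofReal (density o q y)).map (extChartAt (𝓡 n) q).symm := by
  have hS := (isOpen_extChartAt_source (I := 𝓡 n) q).measurableSet
  have hT := (isOpen_extChartAt_target (I := 𝓡 n) q).measurableSet
  ext A hA
  rw [Measure.restrict_apply hA, volMeasure, Measure.sum_apply _ (hA.inter hS),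
    map_extChartAt_symm_apply q _ hA]
  simp only [volMeasure_summand_apply o _ q hA]
  rw [tsum_eq_sum (s := (finite_chartPartition_ne_zero (n := n) (M := M)).toFinset),
    ← lintegral_finsetSum']
  · refine lintegral_congr fun y ↦ ?_
    rw [← ENNReal.ofReal_sum_of_nonneg fun p _ ↦
      mul_nonneg ((chartPartition n M).nonneg p _) (density_nonneg o q y), ← Finset.sum_mul,
      sum_chartPartition, one_mul]
  · intro p _
    refine AEMeasurable.ennreal_ofReal (AEMeasurable.mono_measure ?_
      (Measure.restrict_mono inter_subset_left le_rfl))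
    exact ((((chartPartition n M p).contMDiff.continuous.comp_continuousOn
      (continuousOn_extChartAt_symm q)).mul (continuousOn_density o q))).aemeasurable hT
  · intro p hp
    have : ∀ x, chartPartition n M p x = 0 := by simpa using hp
    simp [this]

theorem volMeasure_image_lt_top (o : ManifoldOrientation n M) (q : M)
    {K : Set (EuclideanSpace ℝ (Fin n))} (hK : IsCompact K)
    (hKt : K ⊆ (extChartAt (𝓡 n) q).target) :
    volMeasure o ((extChartAt (𝓡 n) q).symm '' K) < ⊤ := by
  have hcl := isClosed_symm_image hK hKt
  have hsub : (extChartAt (𝓡 n) q).symm '' K ⊆ (extChartAt (𝓡 n) q).source := by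
    rintro _ ⟨y, hy, rfl⟩
    exact (extChartAt (𝓡 n) q).map_target (hKt hy)
  rw [← Measure.restrict_eq_self _ hsub, volMeasure_restrict_eq,
    map_extChartAt_symm_apply q _ hcl.measurableSet]
  have hs : (extChartAt (𝓡 n) q).target ∩
      (extChartAt (𝓡 n) q).symm ⁻¹' ((extChartAt (𝓡 n) q).symm '' K) = K := by
    ext y
    constructor
    · rintro ⟨hy, z, hz, hzy⟩
      rwa [← (extChartAt (𝓡 n) q).symm.injOn (hKt hz) hy hzy]
    · exact fun hy ↦ ⟨hKt hy, mem_image_of_mem _ hy⟩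
  rw [hs]
  have hi : IntegrableOn (density o q) K volume :=
    ((continuousOn_density o q).mono hKt).integrableOn_compact hK
  exact hi.lintegral_lt_top

theorem isFiniteMeasure_volMeasure (o : ManifoldOrientation n M) :
    IsFiniteMeasure (volMeasure o) := by
  refine ⟨isCompact_univ.measure_lt_top_of_nhdsWithin fun x _ ↦ ?_⟩
  obtain ⟨K, hK, hKn, hKt⟩ := exists_compact_subset (isOpen_extChartAt_target (I := 𝓡 n) x)
    (mem_extChartAt_target x)
  refine ⟨(extChartAt (𝓡 n) x).symm '' K, ?_, volMeasure_image_lt_top o x hK hKt⟩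
  rw [nhdsWithin_univ]
  filter_upwards [extChartAt_source_mem_nhds (I := 𝓡 n) x,
    (continuousAt_extChartAt (I := 𝓡 n) x).preimage_mem_nhds (mem_interior_iff_mem_nhds.1 hKn)]
    with z hz hzK
  exact ⟨_, hzK, (extChartAt (𝓡 n) x).left_inv hz⟩

theorem integral_volMeasure_eq (o : ManifoldOrientation n M) (q : M) {h : M → ℝ}
    (hh : AEStronglyMeasurable h (volMeasure o))
    (h0 : ∀ x ∉ (extChartAt (𝓡 n) q).source, h x = 0) :
    ∫ x, h x ∂(volMeasure o) =
      ∫ y in (extChartAt (𝓡 n) q).target,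
        density o q y * h ((extChartAt (𝓡 n) q).symm y) := by
  have hT := (isOpen_extChartAt_target (I := 𝓡 n) q).measurableSet
  rw [← setIntegral_eq_integral_of_forall_compl_eq_zero h0, volMeasure_restrict_eq,
    integral_map ((aemeasurable_extChartAt_symm q).mono_ac (withDensity_absolutelyContinuous _ _))
      (by rw [← volMeasure_restrict_eq]; exact hh.restrict),
    integral_withDensity_eq_integral_toReal_smul₀
      ((continuousOn_density o q).aemeasurable hT).ennreal_ofReal
      (Eventually.of_forall fun _ ↦ ENNReal.ofReal_lt_top)]
  refine integral_congr_ae (Eventually.of_forall fun y ↦ ?_)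
  simp only [smul_eq_mul]
  rw [ENNReal.toReal_ofReal (density_nonneg o q y)]

theorem volMeasure_ne_zero [Nonempty M] (o : ManifoldOrientation n M) : volMeasure o ≠ 0 := by
  intro h
  obtain ⟨q⟩ := ‹Nonempty M›
  have h1 := volMeasure_restrict_eq o q
  rw [h, Measure.restrict_zero] at h1
  have h2 := map_extChartAt_symm_apply q (fun y ↦ ENNReal.ofReal (density o q y))
    MeasurableSet.univ
  rw [← h1, preimage_univ, inter_univ, Measure.coe_zero, Pi.zero_apply] at h2
  have hT := isOpen_extChartAt_target (I := 𝓡 n) q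
  have h3 := (setLIntegral_eq_zero_iff' hT.measurableSet
    ((continuousOn_density o q).aemeasurable hT.measurableSet).ennreal_ofReal).1 h2.symm
  have h4 : ∀ᵐ y : EuclideanSpace ℝ (Fin n), y ∉ (extChartAt (𝓡 n) q).target := by
    filter_upwards [h3] with y hy hyT
    exact (ENNReal.ofReal_pos.2 (density_pos o hyT)).ne' (hy hyT)
  refine (hT.measure_pos volume ⟨_, mem_extChartAt_target q⟩).ne' ?_
  simpa [ae_iff] using h4

end Measure

theorem contDiff_of_contDiffAt_tsupport {E G : Type*} [NormedAddCommGroup E] [NormedSpace ℝ E]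
    [NormedAddCommGroup G] [NormedSpace ℝ G] {F : E → G}
    (h : ∀ y ∈ tsupport F, ContDiffAt ℝ ∞ F y) : ContDiff ℝ ∞ F := by
  refine contDiff_iff_contDiffAt.2 fun y ↦ ?_
  by_cases hy : y ∈ tsupport F
  · exact h y hy
  · exact contDiffAt_const.congr_of_eventuallyEq (notMem_tsupport_iff_eventuallyEq.1 hy)

theorem setIntegral_mul_wDiv_eq_zero {E : Type*} [NormedAddCommGroup E] [NormedSpace ℝ E]
    [FiniteDimensional ℝ E] [MeasurableSpace E] [BorelSpace E] {μ : Measure E}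
    [μ.IsAddHaarMeasure] {U : Set E} (hU : IsOpen U) {r : E → ℝ}
    (hr : ∀ y ∈ U, ContDiffAt ℝ ∞ r y) (hr0 : ∀ y ∈ U, 0 < r y) {F : E → E}
    (hF : ContDiff ℝ ∞ F) (hc : HasCompactSupport F) (ht : tsupport F ⊆ U) :
    ∫ y in U, r y * wDiv r F y ∂μ = 0 := by
  have hts : tsupport (fun y ↦ r y • F y) ⊆ tsupport F := tsupport_smul_subset_right _ _
  have hsm : ContDiff ℝ ∞ fun y ↦ r y • F y :=
    contDiff_of_contDiffAt_tsupport fun y hy ↦ (hr y (ht (hts hy))).smul hF.contDiffAt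
  have hcs : HasCompactSupport fun y ↦ r y • F y := hc.smul_left
  have h0 : ∀ y ∉ U, eDiv (fun y ↦ r y • F y) y = 0 := by
    intro y hy
    have : (fun y ↦ r y • F y) =ᶠ[𝓝 y] 0 :=
      notMem_tsupport_iff_eventuallyEq.1 fun h ↦ hy (ht (hts h))
    rw [eDiv, this.fderiv_eq]
    simp
  refine Eq.trans ?_ ((setIntegral_eq_integral_of_forall_compl_eq_zero h0).trans
    (integral_eDiv_eq_zero (hsm.of_le (by simp)) hcs μ))
  exact setIntegral_congr_fun hU.measurableSet fun y hy ↦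
    (eDiv_density_smul ((hr y hy).differentiableAt (by simp)) (hr0 y hy).ne'
      (hF.differentiable (by simp) y)).symm

/-! ### The divergence theorem -/

section Stokes

variable {n : ℕ} {M : Type*} [TopologicalSpace M]
  [ChartedSpace (EuclideanSpace ℝ (Fin n)) M] [IsManifold (𝓡 n) ∞ M]

/-- Outside the image of the chart `localRep` takes meaningless values; cutting them off yields a
globally smooth field on the model space, to which the Euclidean divergence theorem applies. -/
theorem localRep_indicator {p : M} {X : SmoothVF n M} {K : Set M} (hK : IsCompact K)
    (hKs : K ⊆ (extChartAt (𝓡 n) p).source) (hX : ∀ x ∉ K, X x = 0) :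
    tsupport ((extChartAt (𝓡 n) p).target.indicator (localRep p X))
      ⊆ (extChartAt (𝓡 n) p).target ∧
    HasCompactSupport ((extChartAt (𝓡 n) p).target.indicator (localRep p X)) ∧
    ContDiff ℝ ∞ ((extChartAt (𝓡 n) p).target.indicator (localRep p X)) := by
  have hKc : IsCompact (extChartAt (𝓡 n) p '' K) :=
    hK.image_of_continuousOn ((continuousOn_extChartAt p).mono hKs)
  have hsub : Function.support ((extChartAt (𝓡 n) p).target.indicator (localRep p X)) ⊆
      extChartAt (𝓡 n) p '' K := by
    intro y hy
    have hyT : y ∈ (extChartAt (𝓡 n) p).target := by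
      by_contra h
      exact hy (indicator_of_notMem h _)
    have hy2 : localRep p X y ≠ 0 := by
      rwa [Function.mem_support, indicator_of_mem hyT] at hy
    refine ⟨(extChartAt (𝓡 n) p).symm y, ?_, (extChartAt (𝓡 n) p).right_inv hyT⟩
    by_contra h
    exact hy2 (by rw [localRep_eq p X hyT, hX _ h, map_zero])
  have hts : tsupport ((extChartAt (𝓡 n) p).target.indicator (localRep p X)) ⊆
      extChartAt (𝓡 n) p '' K := closure_minimal hsub hKc.isClosed
  have hT : extChartAt (𝓡 n) p '' K ⊆ (extChartAt (𝓡 n) p).target := by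
    rintro _ ⟨x, hx, rfl⟩
    exact (extChartAt (𝓡 n) p).map_source (hKs hx)
  refine ⟨hts.trans hT, hKc.of_isClosed_subset (isClosed_tsupport _) hts,
    contDiff_of_contDiffAt_tsupport fun y hy ↦ ?_⟩
  have hyT := hT (hts hy)
  refine (localRep_contDiffAt p X hyT).congr_of_eventuallyEq ?_
  filter_upwards [(isOpen_extChartAt_target p).mem_nhds hyT] with z hz
  exact indicator_of_mem hz _

theorem localRep_eventuallyEq_zero {p x : M} (hx : x ∈ (extChartAt (𝓡 n) p).source)
    {X : SmoothVF n M} (h : ∀ᶠ z in 𝓝 x, X z = 0) :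
    localRep p X =ᶠ[𝓝 (extChartAt (𝓡 n) p x)] 0 := by
  have hc : Tendsto (extChartAt (𝓡 n) p).symm (𝓝 (extChartAt (𝓡 n) p x)) (𝓝 x) := by
    have := (continuousAt_extChartAt_symm' (I := 𝓡 n) hx).tendsto
    rwa [(extChartAt (𝓡 n) p).left_inv hx] at this
  filter_upwards [hc.eventually h, (isOpen_extChartAt_target p).mem_nhds
    ((extChartAt (𝓡 n) p).map_source hx)] with z hz hzT
  rw [localRep_eq p X hzT, hz, map_zero, Pi.zero_apply]

/-- The product of a vector field with a smooth function. -/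
noncomputable def funSmul (f : C^∞⟮𝓡 n, M; ℝ⟯) (X : SmoothVF n M) : SmoothVF n M where
  toFun x := f x • X x
  contMDiff_toFun := f.contMDiff.smul_section X.contMDiff

variable [RiemannianBundle (fun x : M ↦ TangentSpace (𝓡 n) x)]

theorem divVF_eq_zero_of_eventually (o : ManifoldOrientation n M) {X : SmoothVF n M} {x : M}
    (h : ∀ᶠ z in 𝓝 x, X z = 0) : divVF o X x = 0 := by
  rw [divVF, chartDiv, wDiv_congr (localRep_eventuallyEq_zero (mem_extChartAt_source x) h)]
  have : (0 : EuclideanSpace ℝ (Fin n) → EuclideanSpace ℝ (Fin n)) = fun _ ↦ 0 := rfl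
  simp [wDiv, eDiv, this]

variable [IsContMDiffRiemannianBundle (𝓡 n) ∞ (EuclideanSpace ℝ (Fin n))
      (fun x : M ↦ TangentSpace (𝓡 n) x)] [T2Space M] [CompactSpace M]
  [MeasurableSpace M] [BorelSpace M]

theorem integral_divVF_eq_zero_of_subset (o : ManifoldOrientation n M) (hn : 0 < n) {p : M}
    {X : SmoothVF n M} {K : Set M} (hK : IsCompact K)
    (hKs : K ⊆ (extChartAt (𝓡 n) p).source) (hX : ∀ x ∉ K, X x = 0) :
    ∫ x, divVF o X x ∂(volMeasure o) = 0 := by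
  obtain ⟨h1, h2, h3⟩ := localRep_indicator hK hKs hX
  have hopen := isOpen_extChartAt_target (I := 𝓡 n) p
  have h0 : ∀ x ∉ (extChartAt (𝓡 n) p).source, divVF o X x = 0 := by
    intro x hx
    refine divVF_eq_zero_of_eventually o ?_
    filter_upwards [hK.isClosed.isOpen_compl.mem_nhds fun h ↦ hx (hKs h)] with z hz
    exact hX z hz
  rw [integral_volMeasure_eq o p (continuous_divVF o hn X).aestronglyMeasurable h0,
    ← setIntegral_mul_wDiv_eq_zero (μ := volume) hopen (fun y ↦ contDiffAt_density o)
      (fun y ↦ density_pos o) h3 h2 h1]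
  refine setIntegral_congr_fun hopen.measurableSet fun y hy ↦ ?_
  have he : localRep p X =ᶠ[𝓝 y] (extChartAt (𝓡 n) p).target.indicator (localRep p X) := by
    filter_upwards [hopen.mem_nhds hy] with z hz
    exact (indicator_of_mem hz _).symm
  exact congrArg (density o p y * ·) ((divVF_symm_eq o hn X hy).trans (wDiv_congr he))

/-- The partition of unity splits X into finitely many fields supported in single charts, where the
Euclidean statement suffices. -/
theorem integral_divVF_eq_zero (o : ManifoldOrientation n M) (hn : 0 < n) (X : SmoothVF n M) :
    ∫ x, divVF o X x ∂(volMeasure o) = 0 := by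
  have := isFiniteMeasure_volMeasure o
  have hint : ∀ X, Integrable (divVF o X) (volMeasure o) := fun X ↦
    (continuous_divVF o hn X).integrable_of_hasCompactSupport (HasCompactSupport.of_compactSpace _)
  have hX : X = ∑ p ∈ (finite_chartPartition_ne_zero (n := n) (M := M)).toFinset,
      funSmul (chartPartition n M p) X := by
    ext x
    have h1 : (∑ p ∈ (finite_chartPartition_ne_zero (n := n) (M := M)).toFinset,
        funSmul (chartPartition n M p) X) x =
        ∑ p ∈ (finite_chartPartition_ne_zero (n := n) (M := M)).toFinset,
          chartPartition n M p x • X x := by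
      have := congrFun (map_sum (ContMDiffSection.coeAddHom (𝓡 n) (EuclideanSpace ℝ (Fin n)) ∞
        (TangentSpace (𝓡 n) : M → Type _)) (fun p ↦ funSmul (chartPartition n M p) X)
        (finite_chartPartition_ne_zero (n := n) (M := M)).toFinset) x
      rw [Finset.sum_apply] at this
      exact this
    rw [h1, ← Finset.sum_smul, sum_chartPartition, one_smul]
  rw [hX]
  refine Finset.sum_induction _ (fun Z ↦ ∫ x, divVF o Z x ∂(volMeasure o) = 0) ?_ ?_ ?_
  · intro Y Z hY hZ
    simp_rw [divVF_add]
    rw [integral_add (hint Y) (hint Z), hY, hZ, add_zero]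
  · have : ∀ x, divVF o 0 x = 0 := fun x ↦
      divVF_eq_zero_of_eventually o (Eventually.of_forall fun _ ↦ rfl)
    simp [this]
  · intro p _
    refine integral_divVF_eq_zero_of_subset o hn (p := p)
      (isClosed_tsupport (chartPartition n M p)).isCompact (tsupport_chartPartition_subset p) ?_
    intro x hx
    have : chartPartition n M p x = 0 := image_eq_zero_of_notMem_tsupport hx
    exact (congrArg (· • X x) this).trans (zero_smul ℝ _)

/-- Otherwise the divergence is locally constant, hence constant by connectedness. Its integral is
zero while the total volume is positive and finite, so the constant would be zero. -/
theorem exists_fderiv_chartDiv_ne_zero [ConnectedSpace M] (o : ManifoldOrientation n M)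
    (hn : 0 < n) {Y : SmoothVF n M} (hY : Y ∉ divergenceFree o) :
    ∃ (p : M), ∃ q ∈ (extChartAt (𝓡 n) p).target, fderiv ℝ (chartDiv o p Y) q ≠ 0 := by
  by_contra! h
  refine hY ((mem_divergenceFree_iff o hn Y).2 ?_)
  have hl : IsLocallyConstant (divVF o Y) := by
    refine (IsLocallyConstant.iff_eventually_eq _).2 fun x ↦ ?_
    obtain ⟨ε, hε, hB⟩ := Metric.isOpen_iff.1 (isOpen_extChartAt_target (I := 𝓡 n) x) _
      (mem_extChartAt_target x)
    filter_upwards [extChartAt_source_mem_nhds (I := 𝓡 n) x,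
      (continuousAt_extChartAt (I := 𝓡 n) x).preimage_mem_nhds (Metric.ball_mem_nhds _ hε)]
      with z hz hzB
    rw [divVF_eq o hn Y hz, divVF]
    refine Metric.isOpen_ball.is_const_of_fderiv_eq_zero (𝕜 := ℝ)
      (convex_ball _ _).isPreconnected ?_ ?_ hzB (Metric.mem_ball_self hε)
    · exact fun y hy ↦
        ((contDiffAt_chartDiv o Y (hB hy)).differentiableAt (by simp)).differentiableWithinAt
    · exact fun y hy ↦ h x y (hB hy)
  obtain ⟨c, hc⟩ := hl.exists_eq_const
  have h0 := integral_divVF_eq_zero o hn Y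
  have := isFiniteMeasure_volMeasure o
  have := volMeasure_ne_zero o
  rw [hc] at h0 ⊢
  simp only [Function.const_apply, integral_const, smul_eq_mul] at h0
  intro x
  refine (mul_eq_zero.1 h0).resolve_left ?_
  exact ENNReal.toReal_ne_zero.2 ⟨fun h ↦ this (Measure.measure_univ_eq_zero.1 h),
    measure_ne_top _ _⟩

end Stokes

/-! ### Test functions -/

section Test

variable {E : Type*} [NormedAddCommGroup E] [NormedSpace ℝ E]
  {G : Type*} [NormedAddCommGroup G] [NormedSpace ℝ G]

/-- Smooth functions with compact support in `N`. -/
structure IsTest (N : Set E) (F : E → G) : Prop where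
  contDiff : ContDiff ℝ ∞ F
  hasCompactSupport : HasCompactSupport F
  tsupport_subset : tsupport F ⊆ N

theorem IsTest.mono {N N' : Set E} {F : E → G} (h : IsTest N F) (hN : N ⊆ N') : IsTest N' F :=
  ⟨h.1, h.2, h.3.trans hN⟩

theorem IsTest.of_support_subset {G' : Type*} [NormedAddCommGroup G'] [NormedSpace ℝ G']
    {N : Set E} {ψ : E → G'} (hψ : IsTest N ψ) {F : E → G}
    (hF : ∀ y ∈ N, ContDiffAt ℝ ∞ F y) (hs : Function.support F ⊆ tsupport ψ) : IsTest N F := by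
  have h : tsupport F ⊆ tsupport ψ := closure_minimal hs (isClosed_tsupport _)
  exact ⟨contDiff_of_contDiffAt_tsupport fun y hy ↦ hF y (hψ.3 (h hy)),
    hψ.2.of_isClosed_subset (isClosed_tsupport _) h, h.trans hψ.3⟩

theorem IsTest.smul {N : Set E} {ψ : E → ℝ} (hψ : IsTest N ψ) {F : E → G}
    (hF : ∀ y ∈ N, ContDiffAt ℝ ∞ F y) : IsTest N fun y ↦ ψ y • F y :=
  hψ.of_support_subset (fun y hy ↦ hψ.1.contDiffAt.smul (hF y hy)) fun y hy ↦
    subset_tsupport _ fun h ↦ hy (by simp only [h, zero_smul])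

theorem IsTest.mul {N : Set E} {ψ : E → ℝ} (hψ : IsTest N ψ) {f : E → ℝ}
    (hf : ∀ y ∈ N, ContDiffAt ℝ ∞ f y) : IsTest N fun y ↦ ψ y * f y :=
  hψ.smul hf

theorem IsTest.smul_left {N : Set E} {F : E → G} (hF : IsTest N F) {f : E → ℝ}
    (hf : ∀ y ∈ N, ContDiffAt ℝ ∞ f y) : IsTest N fun y ↦ f y • F y :=
  hF.of_support_subset (fun y hy ↦ (hf y hy).smul hF.1.contDiffAt) fun y hy ↦
    subset_tsupport _ fun h ↦ hy (by simp only [h, smul_zero])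

theorem IsTest.add {N : Set E} {F H : E → G} (hF : IsTest N F) (hH : IsTest N H) :
    IsTest N (F + H) :=
  ⟨hF.1.add hH.1, hF.2.add hH.2, (tsupport_add F H).trans (union_subset hF.3 hH.3)⟩

theorem IsTest.curlField [FiniteDimensional ℝ E] {N : Set E} {ψ : E → ℝ} (hψ : IsTest N ψ)
    (u v : E) : IsTest N (curlField ψ u v) :=
  hψ.of_support_subset (fun y _ ↦ contDiffAt_curlField hψ.1.contDiffAt) fun y hy ↦ by
    by_contra h
    refine hy ?_
    rw [VolGeodesic.curlField, (notMem_tsupport_iff_eventuallyEq.1 h).fderiv_eq]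
    simp

theorem curlField_mul {ψ h : E → ℝ} {y : E} (hψ : DifferentiableAt ℝ ψ y)
    (hh : DifferentiableAt ℝ h y) (u v : E) :
    curlField (fun z ↦ ψ z * h z) u v y = h y • curlField ψ u v y + ψ y • curlField h u v y := by
  rw [curlField, fderiv_fun_mul hψ hh]
  simp only [curlField, _root_.add_apply, _root_.smul_apply, smul_eq_mul]
  module

end Test

/-! ### Subalgebras containing the divergence free fields -/

section Subalgebra

variable {n : ℕ} {M : Type*} [TopologicalSpace M]
  [ChartedSpace (EuclideanSpace ℝ (Fin n)) M] [IsManifold (𝓡 n) ∞ M] [T2Space M]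

/-- `F` is a field with compact support in the image of the preferred chart at `p`, and the
corresponding vector field on `M` lies in `𝔤`. -/
def ChartMem (𝔤 : LieSubalgebra ℝ (SmoothVF n M)) (p : M)
    (F : EuclideanSpace ℝ (Fin n) → EuclideanSpace ℝ (Fin n)) : Prop :=
  ∃ h : IsTest (extChartAt (𝓡 n) p).target F, ofChart p F h.1 h.2 h.3 ∈ 𝔤

theorem ofChart_congr {p : M} {F H : EuclideanSpace ℝ (Fin n) → EuclideanSpace ℝ (Fin n)}
    (hF : IsTest (extChartAt (𝓡 n) p).target F) (hH : IsTest (extChartAt (𝓡 n) p).target H)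
    (h : EqOn F H (extChartAt (𝓡 n) p).target) :
    ofChart p F hF.1 hF.2 hF.3 = ofChart p H hH.1 hH.2 hH.3 := by
  ext x
  by_cases hx : x ∈ (extChartAt (𝓡 n) p).source
  · rw [ofChart_apply hx, ofChart_apply hx, h ((extChartAt (𝓡 n) p).map_source hx)]
  · rw [ofChart_apply_of_notMem hx, ofChart_apply_of_notMem hx]

theorem ofChart_add {p : M} {F H : EuclideanSpace ℝ (Fin n) → EuclideanSpace ℝ (Fin n)}
    (hF : IsTest (extChartAt (𝓡 n) p).target F) (hH : IsTest (extChartAt (𝓡 n) p).target H) :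
    ofChart p (F + H) (hF.add hH).1 (hF.add hH).2 (hF.add hH).3 =
      ofChart p F hF.1 hF.2 hF.3 + ofChart p H hH.1 hH.2 hH.3 := by
  ext x
  rw [ContMDiffSection.coe_add, Pi.add_apply]
  by_cases hx : x ∈ (extChartAt (𝓡 n) p).source
  · rw [ofChart_apply hx, ofChart_apply hx, ofChart_apply hx, Pi.add_apply, map_add]
  · rw [ofChart_apply_of_notMem hx, ofChart_apply_of_notMem hx, ofChart_apply_of_notMem hx,
      add_zero]

variable {𝔤 : LieSubalgebra ℝ (SmoothVF n M)} {p : M}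
  {F H : EuclideanSpace ℝ (Fin n) → EuclideanSpace ℝ (Fin n)}

theorem ChartMem.congr (hF : ChartMem 𝔤 p F) (hH : IsTest (extChartAt (𝓡 n) p).target H)
    (h : EqOn F H (extChartAt (𝓡 n) p).target) : ChartMem 𝔤 p H := by
  obtain ⟨hF, hm⟩ := hF
  exact ⟨hH, ofChart_congr hF hH h ▸ hm⟩

theorem ChartMem.add (hF : ChartMem 𝔤 p F) (hH : ChartMem 𝔤 p H) : ChartMem 𝔤 p (F + H) := by
  obtain ⟨hF, hm⟩ := hF
  obtain ⟨hH, hm'⟩ := hH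
  exact ⟨hF.add hH, by rw [ofChart_add hF hH]; exact 𝔤.add_mem hm hm'⟩

theorem ChartMem.zero : ChartMem 𝔤 p 0 := by
  have h : IsTest (extChartAt (𝓡 n) p).target
      (0 : EuclideanSpace ℝ (Fin n) → EuclideanSpace ℝ (Fin n)) :=
    ⟨contDiff_const, HasCompactSupport.zero, by simp⟩
  refine ⟨h, ?_⟩
  have : ofChart p 0 h.1 h.2 h.3 = 0 := by
    ext x
    by_cases hx : x ∈ (extChartAt (𝓡 n) p).source
    · rw [ofChart_apply hx, Pi.zero_apply, map_zero]; rfl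
    · rw [ofChart_apply_of_notMem hx]; rfl
  rw [this]
  exact 𝔤.zero_mem

theorem ofChart_eventually_eq_zero (hF : IsTest (extChartAt (𝓡 n) p).target F) {x : M}
    (hx : x ∉ (extChartAt (𝓡 n) p).source) :
    ∀ᶠ z in 𝓝 x, ofChart p F hF.1 hF.2 hF.3 z = 0 := by
  have hcl := isClosed_symm_image (p := p) hF.2 hF.3
  have hxn : x ∉ (extChartAt (𝓡 n) p).symm '' tsupport F := by
    rintro ⟨y, hy, rfl⟩
    exact hx ((extChartAt (𝓡 n) p).map_target (hF.3 hy))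
  filter_upwards [hcl.isOpen_compl.mem_nhds hxn] with z hz
  by_cases hzs : z ∈ (extChartAt (𝓡 n) p).source
  · have : extChartAt (𝓡 n) p z ∉ tsupport F := fun h ↦
      hz ⟨_, h, (extChartAt (𝓡 n) p).left_inv hzs⟩
    rw [ofChart_apply hzs, image_eq_zero_of_notMem_tsupport this, map_zero]
  · exact ofChart_apply_of_notMem hzs

variable [RiemannianBundle (fun x : M ↦ TangentSpace (𝓡 n) x)]

theorem chartDiv_ofChart (o : ManifoldOrientation n M)
    (hF : IsTest (extChartAt (𝓡 n) p).target F) {y : EuclideanSpace ℝ (Fin n)}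
    (hy : y ∈ (extChartAt (𝓡 n) p).target) :
    chartDiv o p (ofChart p F hF.1 hF.2 hF.3) y = wDiv (density o p) F y :=
  wDiv_congr (localRep_ofChart_eventuallyEq hy)

variable [IsContMDiffRiemannianBundle (𝓡 n) ∞ (EuclideanSpace ℝ (Fin n))
      (fun x : M ↦ TangentSpace (𝓡 n) x)] {o : ManifoldOrientation n M}

theorem ofChart_mem_divergenceFree (hn : 0 < n) (hF : IsTest (extChartAt (𝓡 n) p).target F)
    (h : ∀ y ∈ (extChartAt (𝓡 n) p).target, wDiv (density o p) F y = 0) :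
    ofChart p F hF.1 hF.2 hF.3 ∈ divergenceFree o := by
  refine (mem_divergenceFree_iff o hn _).2 fun x ↦ ?_
  by_cases hx : x ∈ (extChartAt (𝓡 n) p).source
  · have hy := (extChartAt (𝓡 n) p).map_source hx
    rw [divVF_eq o hn _ hx, chartDiv_ofChart o hF hy, h _ hy]
  · exact divVF_eq_zero_of_eventually o (ofChart_eventually_eq_zero hF hx)

/-- Two fields with equal divergence differ by a divergence free field, which lies in 𝔤 already. -/
theorem mem_of_divVF_eq (hn : 0 < n) (h𝔤 : divergenceFree o ⊆ (𝔤 : Set (SmoothVF n M)))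
    {X Y : SmoothVF n M} (hX : X ∈ 𝔤) (h : ∀ x, divVF o X x = divVF o Y x) : Y ∈ 𝔤 := by
  have h1 : Y - X ∈ divergenceFree o := (mem_divergenceFree_iff o hn _).2 fun x ↦ by
    rw [divVF_sub, h, sub_self]
  have h2 := 𝔤.add_mem (h𝔤 h1) hX
  rwa [sub_add_cancel] at h2

/-- For F divergence free, [F,Y] has divergence F(div Y), and so does (div Y)F. -/
theorem chartMem_smul_of_wDiv_eq_zero (hn : 0 < n)
    (h𝔤 : divergenceFree o ⊆ (𝔤 : Set (SmoothVF n M)))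
    (hF : IsTest (extChartAt (𝓡 n) p).target F)
    (h : ∀ y ∈ (extChartAt (𝓡 n) p).target, wDiv (density o p) F y = 0)
    {Y : SmoothVF n M} (hY : Y ∈ 𝔤) : ChartMem 𝔤 p fun y ↦ chartDiv o p Y y • F y := by
  have hF' : IsTest (extChartAt (𝓡 n) p).target fun y ↦ chartDiv o p Y y • F y :=
    hF.smul_left fun y hy ↦ contDiffAt_chartDiv o Y hy
  refine ⟨hF', mem_of_divVF_eq hn h𝔤
    (𝔤.lie_mem (h𝔤 (ofChart_mem_divergenceFree hn hF h)) hY) fun x ↦ ?_⟩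
  by_cases hx : x ∈ (extChartAt (𝓡 n) p).source
  · have hy := (extChartAt (𝓡 n) p).map_source hx
    have h0 : chartDiv o p (ofChart p F hF.1 hF.2 hF.3) =ᶠ[𝓝 (extChartAt (𝓡 n) p x)] 0 := by
      filter_upwards [(isOpen_extChartAt_target p).mem_nhds hy] with z hz
      rw [chartDiv_ofChart o hF hz, h z hz, Pi.zero_apply]
    rw [divVF_eq o hn _ hx, divVF_eq o hn _ hx, chartDiv_lie o _ _ hy, h0.fderiv_eq,
      chartDiv_ofChart o hF' hy, wDiv_smul
        ((contDiffAt_chartDiv o Y hy).differentiableAt (by simp))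
        (hF.1.differentiable (by simp) _), h _ hy, localRep_ofChart hy]
    simp
  · rw [divVF_eq_zero_of_eventually o (ofChart_eventually_eq_zero hF' hx), divVF,
      chartDiv_lie o _ _ (mem_extChartAt_target x)]
    have h1 := localRep_eventuallyEq_zero (mem_extChartAt_source (I := 𝓡 n) x)
      (ofChart_eventually_eq_zero hF hx)
    have h2 : chartDiv o x (ofChart p F hF.1 hF.2 hF.3) =ᶠ[𝓝 (extChartAt (𝓡 n) x x)] 0 := by
      filter_upwards [h1.eventuallyEq_nhds] with z hz
      have : (0 : EuclideanSpace ℝ (Fin n) → EuclideanSpace ℝ (Fin n)) = fun _ ↦ 0 := rfl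
      rw [chartDiv, wDiv_congr hz]
      simp [wDiv, eDiv, this]
    rw [h1.eq_of_nhds, h2.fderiv_eq]
    simp

theorem contDiffAt_density_inv {y : EuclideanSpace ℝ (Fin n)}
    (hy : y ∈ (extChartAt (𝓡 n) p).target) :
    ContDiffAt ℝ ∞ (fun z ↦ (density o p z)⁻¹) y :=
  (contDiffAt_density o hy).inv (density_pos o hy).ne'

theorem isTest_inv_density_smul_curlField {N : Set (EuclideanSpace ℝ (Fin n))}
    (hN : N ⊆ (extChartAt (𝓡 n) p).target)
    {ψ : EuclideanSpace ℝ (Fin n) → ℝ} (hψ : IsTest N ψ) (u v : EuclideanSpace ℝ (Fin n)) :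
    IsTest N fun y ↦ (density o p y)⁻¹ • curlField ψ u v y :=
  (hψ.curlField u v).smul_left fun _ hy ↦ contDiffAt_density_inv (hN hy)

theorem wDiv_inv_density_smul_curlField {ψ : EuclideanSpace ℝ (Fin n) → ℝ}
    {u v y : EuclideanSpace ℝ (Fin n)} (hy : y ∈ (extChartAt (𝓡 n) p).target)
    (hψ : ContDiff ℝ ∞ ψ) :
    wDiv (density o p) (fun y ↦ (density o p y)⁻¹ • curlField ψ u v y) y = 0 :=
  wDiv_inv_smul_curlField (contDiffAt_density o hy) (density_pos o hy).ne' hψ.contDiffAt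

theorem isTest_smul_curlField {h ψ : EuclideanSpace ℝ (Fin n) → ℝ}
    (hh : ∀ y ∈ (extChartAt (𝓡 n) p).target, ContDiffAt ℝ ∞ h y)
    (hψ : IsTest (extChartAt (𝓡 n) p).target ψ) (u v : EuclideanSpace ℝ (Fin n)) :
    IsTest (extChartAt (𝓡 n) p).target
      fun y ↦ (density o p y)⁻¹ • (ψ y • curlField h u v y) :=
  (hψ.smul fun y hy ↦ contDiffAt_curlField (hh y hy)).smul_left fun _ hy ↦
    contDiffAt_density_inv hy

/-- Both ρ⁻¹ curl(ψh) and ρ⁻¹h curl ψ belong to 𝔤, where h = div Y; by the Leibniz rule their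
difference is ρ⁻¹ψ curl h. The gain is that ψ is now an arbitrary coefficient instead of being
differentiated. -/
theorem chartMem_smul_curlField (hn : 0 < n)
    (h𝔤 : divergenceFree o ⊆ (𝔤 : Set (SmoothVF n M)))
    {ψ : EuclideanSpace ℝ (Fin n) → ℝ} (hψ : IsTest (extChartAt (𝓡 n) p).target ψ)
    {Y : SmoothVF n M} (hY : Y ∈ 𝔤) (u v : EuclideanSpace ℝ (Fin n)) :
    ChartMem 𝔤 p fun y ↦ (density o p y)⁻¹ • (ψ y • curlField (chartDiv o p Y) u v y) := by
  have hYd := fun y (hy : y ∈ (extChartAt (𝓡 n) p).target) ↦ contDiffAt_chartDiv o Y hy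
  have hψY := hψ.mul hYd
  have h1 : ChartMem 𝔤 p fun y ↦ (density o p y)⁻¹ •
      curlField (fun z ↦ ψ z * chartDiv o p Y z) u v y :=
    ⟨isTest_inv_density_smul_curlField (o := o) subset_rfl hψY u v,
      h𝔤 (ofChart_mem_divergenceFree hn
        (isTest_inv_density_smul_curlField (o := o) subset_rfl hψY u v) fun y hy ↦
          wDiv_inv_density_smul_curlField hy hψY.1)⟩
  -- Swapping `u` and `v` changes the sign of the curl, so that adding this field performs the
  -- subtraction.
  have h2 := chartMem_smul_of_wDiv_eq_zero hn h𝔤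
    (isTest_inv_density_smul_curlField (o := o) subset_rfl hψ v u)
    (fun y hy ↦ wDiv_inv_density_smul_curlField hy hψ.1) hY
  refine (h1.add h2).congr (isTest_smul_curlField hYd hψ u v) fun y hy ↦ ?_
  simp only [Pi.add_apply]
  rw [curlField_mul (hψ.1.differentiable (by simp) y) ((hYd y hy).differentiableAt (by simp))]
  have : curlField ψ v u y = - curlField ψ u v y := by simp [curlField]
  rw [this]
  module

end Subalgebra

/-! ### Fields with small support in the subalgebra -/

theorem exists_dual_eq_zero_ne_zero {n : ℕ} (hn : 2 ≤ n) (u : EuclideanSpace ℝ (Fin n)) :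
    ∃ (l : EuclideanSpace ℝ (Fin n) →L[ℝ] ℝ) (w : EuclideanSpace ℝ (Fin n)),
      l u = 0 ∧ l w = 1 := by
  obtain ⟨w, hw⟩ : ∃ w, w ∉ Submodule.span ℝ {u} := by
    by_contra! h
    have h1 : (Submodule.span ℝ {u}) = ⊤ := Submodule.eq_top_iff'.2 h
    have h2 : Module.finrank ℝ (Submodule.span ℝ {u}) ≤ 1 := by
      simpa using finrank_span_le_card (R := ℝ) {u}
    rw [h1, finrank_top, finrank_euclideanSpace_fin] at h2
    omega
  obtain ⟨f, hf, hfu⟩ := Submodule.exists_le_ker_of_notMem hw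
  refine ⟨LinearMap.toContinuousLinearMap ((f w)⁻¹ • f), w, ?_, ?_⟩
  · have : f u = 0 := hfu (Submodule.mem_span_singleton_self u)
    simp [this]
  · simp [inv_mul_cancel₀ hf]

section Small

variable {n : ℕ} {M : Type*} [TopologicalSpace M]
  [ChartedSpace (EuclideanSpace ℝ (Fin n)) M] [IsManifold (𝓡 n) ∞ M] [T2Space M]
  {𝔤 : LieSubalgebra ℝ (SmoothVF n M)} {p : M}
  [RiemannianBundle (fun x : M ↦ TangentSpace (𝓡 n) x)]
  [IsContMDiffRiemannianBundle (𝓡 n) ∞ (EuclideanSpace ℝ (Fin n))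
      (fun x : M ↦ TangentSpace (𝓡 n) x)] {o : ManifoldOrientation n M}

/-- From the derivative of one divergence one obtains a second, independent one. -/
theorem exists_chartDiv_independent (hn : 0 < n)
    (h𝔤 : divergenceFree o ⊆ (𝔤 : Set (SmoothVF n M)))
    {Y : SmoothVF n M} (hY : Y ∈ 𝔤) {q : EuclideanSpace ℝ (Fin n)}
    (hq : q ∈ (extChartAt (𝓡 n) p).target)
    {l : EuclideanSpace ℝ (Fin n) →L[ℝ] ℝ} {u w : EuclideanSpace ℝ (Fin n)}
    (hu : fderiv ℝ (chartDiv o p Y) q u ≠ 0) (hlu : l u = 0) (hlw : l w = 1) :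
    ∃ Y' ∈ 𝔤, fderiv ℝ (chartDiv o p Y') q u = 0 ∧ fderiv ℝ (chartDiv o p Y') q w ≠ 0 := by
  set T := (extChartAt (𝓡 n) p).target
  have hT : IsOpen T := isOpen_extChartAt_target p
  obtain ⟨χ, hχ1, hχ2, hχ3, hχ⟩ := exists_smooth_bump (hT.mem_nhds hq)
  -- Near q one has dψ = l(y - q) l. The new divergence ρ⁻¹ dψ(curl h) is then l(y - q) times a
  -- function which is nonzero at q, so its differential at q is a nonzero multiple of l; this kills
  -- u but not w.
  set ψ : EuclideanSpace ℝ (Fin n) → ℝ := fun y ↦ χ y * (l (y - q) ^ 2 / 2)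
  have hl : ContDiff ℝ ∞ fun y ↦ l (y - q) ^ 2 / 2 :=
    ((l.contDiff.comp (contDiff_id.sub contDiff_const)).pow 2).div_const 2
  have hψ : IsTest T ψ := IsTest.mul ⟨hχ1, hχ2, hχ3⟩ fun y _ ↦ hl.contDiffAt
  obtain ⟨hF, hm⟩ := chartMem_smul_curlField (o := o) hn h𝔤 hψ hY u w
  set h := chartDiv o p Y
  have hh : ∀ y ∈ T, ContDiffAt ℝ ∞ h y := fun y hy ↦ contDiffAt_chartDiv o Y hy
  refine ⟨_, hm, ?_⟩
  have hlder : ∀ y, HasFDerivAt (fun y ↦ l (y - q) ^ 2 / 2) (l (y - q) • l) y := fun y ↦ by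
    have h1 : HasFDerivAt (fun y ↦ l (y - q)) l y :=
      l.hasFDerivAt.comp y ((hasFDerivAt_id y).sub_const q)
    refine ((h1.pow 2).mul_const (2 : ℝ)⁻¹).congr_fderiv ?_
    ext v
    simp
    ring
  have hev : ∀ᶠ y in 𝓝 q, chartDiv o p (ofChart p _ hF.1 hF.2 hF.3) y =
      l (y - q) * (-((density o p y)⁻¹ * fderiv ℝ h y u)) := by
    filter_upwards [hT.mem_nhds hq, hχ.eventuallyEq_nhds] with y hy hχy
    have hψd : fderiv ℝ ψ y = l (y - q) • l := by
      have : ψ =ᶠ[𝓝 y] fun y ↦ l (y - q) ^ 2 / 2 := by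
        filter_upwards [hχy] with z hz
        simp only [ψ, hz, Pi.one_apply, one_mul]
      rw [this.fderiv_eq, (hlder y).fderiv]
    have hc := (contDiffAt_curlField (u := u) (v := w) (hh y hy)).differentiableAt (by simp)
    have hψy := hψ.1.differentiable (by simp) y
    rw [chartDiv_ofChart o hF hy, wDiv_inv_smul (F := fun y ↦ ψ y • curlField h u w y)
      ((contDiffAt_density o hy).differentiableAt (by simp)) (density_pos o hy).ne'
      (hψy.smul hc), eDiv_smul hψy hc, eDiv_curlField ((hh y hy).of_le two_le_infty), hψd]
    simp only [curlField, _root_.smul_apply, map_sub, map_smul, smul_eq_mul, hlu, hlw]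
    ring
  have hd1 : HasFDerivAt (fun y ↦ l (y - q)) l q :=
    l.hasFDerivAt.comp q ((hasFDerivAt_id q).sub_const q)
  have hd2 : DifferentiableAt ℝ (fun y ↦ -((density o p y)⁻¹ * fderiv ℝ h y u)) q := by
    have h1 := contDiffAt_density_inv (o := o) hq
    have h2 : ContDiffAt ℝ ∞ (fderiv ℝ h) q := (hh q hq).fderiv_right (m := ∞) (by simp)
    exact ((h1.mul (h2.clm_apply contDiffAt_const)).neg).differentiableAt (by simp)
  rw [Filter.EventuallyEq.fderiv_eq hev, fderiv_fun_mul hd1.differentiableAt hd2, hd1.fderiv]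
  simp only [_root_.add_apply, _root_.smul_apply, smul_eq_mul, sub_self, map_zero, hlu, hlw]
  refine ⟨by ring, ?_⟩
  have := density_pos o hq
  simp only [zero_mul, zero_add, mul_one, neg_ne_zero]
  exact mul_ne_zero (inv_ne_zero this.ne') hu

/-- The curls of h and h' in the plane of u and w are independent near q, so combining them with
arbitrary coefficients isolates the direction u. Once multiples of u are available, the curl of h in
the plane of u and v yields multiples of any v, because ∂_u h ≠ 0. -/
theorem exists_nhds_chartMem (hn : 2 ≤ n) (h𝔤 : divergenceFree o ⊆ (𝔤 : Set (SmoothVF n M)))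
    {Y : SmoothVF n M} (hY : Y ∈ 𝔤) {q : EuclideanSpace ℝ (Fin n)}
    (hq : q ∈ (extChartAt (𝓡 n) p).target) (hd : fderiv ℝ (chartDiv o p Y) q ≠ 0) :
    ∃ N ∈ 𝓝 q, N ⊆ (extChartAt (𝓡 n) p).target ∧ ∀ F, IsTest N F → ChartMem 𝔤 p F := by
  have hn0 : 0 < n := by omega
  obtain ⟨u, hu⟩ : ∃ u, fderiv ℝ (chartDiv o p Y) q u ≠ 0 := by
    by_contra! h
    exact hd (ContinuousLinearMap.ext h)
  obtain ⟨l, w, hlu, hlw⟩ := exists_dual_eq_zero_ne_zero hn u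
  obtain ⟨Y', hY', hu', hw'⟩ := exists_chartDiv_independent hn0 h𝔤 hY hq hu hlu hlw
  set T := (extChartAt (𝓡 n) p).target
  have hT : IsOpen T := isOpen_extChartAt_target p
  set h := chartDiv o p Y
  set h' := chartDiv o p Y'
  have hh : ∀ v, ∀ y ∈ T, ContDiffAt ℝ ∞ (fun y ↦ fderiv ℝ h y v) y := fun v y hy ↦
    ((contDiffAt_chartDiv o Y hy).fderiv_right (m := ∞) (by simp)).clm_apply contDiffAt_const
  have hh' : ∀ v, ∀ y ∈ T, ContDiffAt ℝ ∞ (fun y ↦ fderiv ℝ h' y v) y := fun v y hy ↦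
    ((contDiffAt_chartDiv o Y' hy).fderiv_right (m := ∞) (by simp)).clm_apply contDiffAt_const
  -- The determinant of (dh, dh') on (u, w); at q it reduces to a product of two nonzero derivatives
  -- because dh'(u) = 0 there.
  set D : EuclideanSpace ℝ (Fin n) → ℝ := fun y ↦
    fderiv ℝ h y u * fderiv ℝ h' y w - fderiv ℝ h y w * fderiv ℝ h' y u with hDdef
  have hD : ∀ y ∈ T, ContDiffAt ℝ ∞ D y := fun y hy ↦
    ((hh u y hy).mul (hh' w y hy)).sub ((hh w y hy).mul (hh' u y hy))
  have hDq : D q ≠ 0 := by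
    simp only [hDdef, hu', mul_zero, sub_zero]
    exact mul_ne_zero hu hw'
  set N := {y | y ∈ T ∧ fderiv ℝ h y u ≠ 0 ∧ D y ≠ 0} with hN
  have hNT : N ⊆ T := fun y hy ↦ hy.1
  have hr : ∀ y ∈ T, ContDiffAt ℝ ∞ (density o p) y := fun y hy ↦ contDiffAt_density o hy
  have hr0 : ∀ y ∈ T, density o p y ≠ 0 := fun y hy ↦ (density_pos o hy).ne'
  refine ⟨N, ?_, hNT, ?_⟩
  · filter_upwards [hT.mem_nhds hq, (hh u q hq).continuousAt.eventually_ne hu,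
      (hD q hq).continuousAt.eventually_ne hDq] with y h1 h2 h3
    exact ⟨h1, h2, h3⟩
  have hmemu : ∀ φ : EuclideanSpace ℝ (Fin n) → ℝ, IsTest N φ →
      ChartMem 𝔤 p fun y ↦ φ y • u := by
    intro φ hφ
    -- Cramer's rule: the coefficients -∂_u h'/D and ∂_u h/D of the two curls cancel the w component
    -- and give u component 1. The factor of the density compensates ρ⁻¹.
    have hψ1 : IsTest N fun y ↦ φ y * (density o p y * (-(fderiv ℝ h' y u * (D y)⁻¹))) :=
      hφ.mul fun y hy ↦ (hr y hy.1).mul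
        ((hh' u y hy.1).mul ((hD y hy.1).inv hy.2.2)).neg
    have hψ2 : IsTest N fun y ↦ φ y * (density o p y * (fderiv ℝ h y u * (D y)⁻¹)) :=
      hφ.mul fun y hy ↦ (hr y hy.1).mul ((hh u y hy.1).mul ((hD y hy.1).inv hy.2.2))
    refine ((chartMem_smul_curlField (o := o) hn0 h𝔤 (hψ1.mono hNT) hY u w).add
      (chartMem_smul_curlField (o := o) hn0 h𝔤 (hψ2.mono hNT) hY' u w)).congr
      ((hφ.smul fun y _ ↦ contDiffAt_const).mono hNT) fun y hy ↦ ?_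
    simp only [Pi.add_apply]
    by_cases hyN : y ∈ N
    · have h1 := hr0 y hy
      have h2 := hyN.2.2
      simp only [curlField]
      have e1 : (density o p y)⁻¹ * (φ y * (density o p y * (-(fderiv ℝ h' y u * (D y)⁻¹))))
          * fderiv ℝ h y w + (density o p y)⁻¹ * (φ y * (density o p y *
            (fderiv ℝ h y u * (D y)⁻¹))) * fderiv ℝ h' y w = φ y := by
        field_simp
        simp only [hDdef]
        ring
      have e2 : (density o p y)⁻¹ * (φ y * (density o p y * (-(fderiv ℝ h' y u * (D y)⁻¹))))
          * fderiv ℝ h y u + (density o p y)⁻¹ * (φ y * (density o p y *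
            (fderiv ℝ h y u * (D y)⁻¹))) * fderiv ℝ h' y u = 0 := by
        ring
      calc _ = ((density o p y)⁻¹ * (φ y * (density o p y * (-(fderiv ℝ h' y u * (D y)⁻¹))))
          * fderiv ℝ h y w + (density o p y)⁻¹ * (φ y * (density o p y *
            (fderiv ℝ h y u * (D y)⁻¹))) * fderiv ℝ h' y w) • u
          - ((density o p y)⁻¹ * (φ y * (density o p y * (-(fderiv ℝ h' y u * (D y)⁻¹))))
          * fderiv ℝ h y u + (density o p y)⁻¹ * (φ y * (density o p y *
            (fderiv ℝ h y u * (D y)⁻¹))) * fderiv ℝ h' y u) • w := by module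
        _ = _ := by rw [e1, e2, zero_smul, sub_zero]
    · have : φ y = 0 := image_eq_zero_of_notMem_tsupport fun h ↦ hyN (hφ.3 h)
      simp [this]
  have hmem : ∀ (v : EuclideanSpace ℝ (Fin n)) (φ : EuclideanSpace ℝ (Fin n) → ℝ), IsTest N φ →
      ChartMem 𝔤 p fun y ↦ φ y • v := by
    intro v φ hφ
    -- Multiplying the curl ∂_v h u - ∂_u h v by -φ/∂_u h gives φ v minus a multiple of u, and that
    -- multiple is restored by `hmemu`.
    have hψ1 : IsTest N fun y ↦ φ y * (density o p y * (-(fderiv ℝ h y u)⁻¹)) :=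
      hφ.mul fun y hy ↦ (hr y hy.1).mul ((hh u y hy.1).inv hy.2.1).neg
    have hψ2 : IsTest N fun y ↦ φ y * (fderiv ℝ h y v * (fderiv ℝ h y u)⁻¹) :=
      hφ.mul fun y hy ↦ (hh v y hy.1).mul ((hh u y hy.1).inv hy.2.1)
    refine ((chartMem_smul_curlField (o := o) hn0 h𝔤 (hψ1.mono hNT) hY u v).add
      (hmemu _ hψ2)).congr
      ((hφ.smul fun y _ ↦ contDiffAt_const).mono hNT) fun y hy ↦ ?_
    simp only [Pi.add_apply]
    by_cases hyN : y ∈ N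
    · have h1 := hr0 y hy
      have h2 := hyN.2.1
      have e1 : (density o p y)⁻¹ * (φ y * (density o p y * (-(fderiv ℝ h y u)⁻¹)))
          * fderiv ℝ h y u = - φ y := by
        field_simp
      have e2 : (density o p y)⁻¹ * (φ y * (density o p y * (-(fderiv ℝ h y u)⁻¹)))
          * fderiv ℝ h y v + φ y * (fderiv ℝ h y v * (fderiv ℝ h y u)⁻¹) = 0 := by
        field_simp
        ring
      simp only [curlField]
      calc _ = ((density o p y)⁻¹ * (φ y * (density o p y * (-(fderiv ℝ h y u)⁻¹)))
          * fderiv ℝ h y v + φ y * (fderiv ℝ h y v * (fderiv ℝ h y u)⁻¹)) • u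
          - ((density o p y)⁻¹ * (φ y * (density o p y * (-(fderiv ℝ h y u)⁻¹)))
          * fderiv ℝ h y u) • v := by module
        _ = _ := by rw [e1, e2, zero_smul, zero_sub, neg_smul, neg_neg]
    · have : φ y = 0 := image_eq_zero_of_notMem_tsupport fun h ↦ hyN (hφ.3 h)
      simp [this]
  intro F hF
  have hsum : ChartMem 𝔤 p
      (∑ i, fun y ↦ F y i • EuclideanSpace.basisFun (Fin n) ℝ i) := by
    refine Finset.sum_induction _ (ChartMem 𝔤 p) (fun _ _ h1 h2 ↦ h1.add h2) ChartMem.zero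
      fun i _ ↦ hmem _ _ ?_
    refine hF.of_support_subset (fun y _ ↦ ?_) fun y hy ↦ subset_tsupport _ fun h ↦ hy ?_
    · exact (EuclideanSpace.proj i : EuclideanSpace ℝ (Fin n) →L[ℝ] ℝ).contDiff.contDiffAt.comp y
        hF.1.contDiffAt
    · simp only [h]; rfl
  refine hsum.congr (hF.mono hNT) fun y _ ↦ ?_
  rw [Finset.sum_apply]
  have := (EuclideanSpace.basisFun (Fin n) ℝ).sum_repr (F y)
  simpa using this

end Small

/-! ### Gradient fields -/

section Gradient

variable {E : Type*} [NormedAddCommGroup E] [NormedSpace ℝ E] [FiniteDimensional ℝ E]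

/-- Ensures that `ContinuousLinearMap.inverse`, which is zero by convention on noninvertible maps,
is the true inverse of the metric in `gradField`. -/
theorem exists_equiv_of_posDef {B : E →L[ℝ] E →L[ℝ] ℝ} (hB : ∀ v, v ≠ 0 → 0 < B v v) :
    ∃ e : E ≃L[ℝ] (E →L[ℝ] ℝ), (e : E →L[ℝ] E →L[ℝ] ℝ) = B := by
  have hinj : Function.Injective (B : E →ₗ[ℝ] E →L[ℝ] ℝ) := by
    refine (injective_iff_map_eq_zero _).2 fun v hv ↦ ?_
    by_contra h
    have h1 : B v = 0 := hv
    have := hB v h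
    simp [h1] at this
  have hfr : Module.finrank ℝ E = Module.finrank ℝ (E →L[ℝ] ℝ) := by
    have h1 : Module.finrank ℝ (E →ₗ[ℝ] ℝ) = Module.finrank ℝ (E →L[ℝ] ℝ) :=
      (LinearMap.toContinuousLinearMap (𝕜 := ℝ) (E := E) (F' := ℝ)).finrank_eq
    exact (Subspace.dual_finrank_eq (K := ℝ) (V := E)).symm.trans h1
  refine ⟨(LinearMap.linearEquivOfInjective _ hinj hfr).toContinuousLinearEquiv, ?_⟩
  ext v w
  rfl

/-- The gradient of `f` with respect to the metric `G`. -/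
noncomputable def gradField (G : E → E →L[ℝ] E →L[ℝ] ℝ) (f : E → ℝ) (y : E) : E :=
  (G y).inverse (fderiv ℝ f y)

theorem metric_gradField {G : E → E →L[ℝ] E →L[ℝ] ℝ} {f : E → ℝ} {y : E}
    (hG : ∀ v, v ≠ 0 → 0 < G y v v) : G y (gradField G f y) = fderiv ℝ f y := by
  obtain ⟨e, he⟩ := exists_equiv_of_posDef hG
  rw [gradField, ← he, ContinuousLinearMap.inverse_equiv]
  exact e.apply_symm_apply _

theorem contDiffAt_gradField {G : E → E →L[ℝ] E →L[ℝ] ℝ} {f : E → ℝ} {y : E}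
    (hG : ∀ v, v ≠ 0 → 0 < G y v v) (hGs : ContDiffAt ℝ ∞ G y) (hf : ContDiffAt ℝ ∞ f y) :
    ContDiffAt ℝ ∞ (gradField G f) y := by
  obtain ⟨e, he⟩ := exists_equiv_of_posDef hG
  have h1 : ContDiffAt ℝ ∞ ContinuousLinearMap.inverse (G y) := he ▸ contDiffAt_map_inverse e
  exact (h1.comp y hGs).clm_apply (hf.fderiv_right (m := ∞) (by simp))

theorem isTest_gradField {N : Set E} {G : E → E →L[ℝ] E →L[ℝ] ℝ} {f : E → ℝ}
    (hG : ∀ y ∈ N, ∀ v, v ≠ 0 → 0 < G y v v) (hGs : ∀ y ∈ N, ContDiffAt ℝ ∞ G y)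
    (hf : IsTest N f) : IsTest N (gradField G f) := by
  refine hf.of_support_subset
    (fun y hy ↦ contDiffAt_gradField (hG y hy) (hGs y hy) hf.1.contDiffAt) fun y hy ↦ ?_
  by_contra h
  refine hy ?_
  rw [gradField, (notMem_tsupport_iff_eventuallyEq.1 h).fderiv_eq]
  simp

/-- Near any point there is a gradient field which is infinitesimally the radial field. -/
theorem exists_gradField_radial {N : Set E} {q : E} (hN : N ∈ 𝓝 q)
    {G : E → E →L[ℝ] E →L[ℝ] ℝ}
    (hG : ∀ y ∈ N, ∀ v, v ≠ 0 → 0 < G y v v) (hGs : ∀ y ∈ N, ContDiffAt ℝ ∞ G y)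
    (hsymm : ∀ v w, G q v w = G q w v) :
    ∃ f, IsTest N f ∧ gradField G f q = 0 ∧
      fderiv ℝ (gradField G f) q = ContinuousLinearMap.id ℝ E := by
  have hq := mem_of_mem_nhds hN
  obtain ⟨χ, hχ1, hχ2, hχ3, hχ⟩ := exists_smooth_bump hN
  have hd : ∀ y, HasFDerivAt (fun y ↦ (2 : ℝ)⁻¹ * G q (y - q) (y - q)) (G q (y - q)) y := by
    intro y
    have h1 : HasFDerivAt (fun y ↦ y - q) (ContinuousLinearMap.id ℝ E) y :=
      (hasFDerivAt_id y).sub_const q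
    have h2 := (((G q).hasFDerivAt.comp y h1).clm_apply h1).const_mul (2 : ℝ)⁻¹
    refine h2.congr_fderiv ?_
    ext v
    simp only [_root_.smul_apply, _root_.add_apply, ContinuousLinearMap.comp_apply,
      ContinuousLinearMap.flip_apply, ContinuousLinearMap.id_apply, smul_eq_mul,
      Function.comp_apply]
    rw [hsymm v]
    ring
  have hs : ContDiff ℝ ∞ fun y ↦ (2 : ℝ)⁻¹ * G q (y - q) (y - q) :=
    contDiff_const.mul (((G q).contDiff.comp (contDiff_id.sub contDiff_const)).clm_apply
      (contDiff_id.sub contDiff_const))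
  -- Half the squared distance to q for the metric frozen at q. Near q its gradient Z satisfies G_y
  -- Z(y) = G_q(y - q).
  set f : E → ℝ := fun y ↦ χ y * ((2 : ℝ)⁻¹ * G q (y - q) (y - q))
  have hf : IsTest N f := IsTest.mul ⟨hχ1, hχ2, hχ3⟩ fun y _ ↦ hs.contDiffAt
  have hev : ∀ᶠ y in 𝓝 q, G y (gradField G f y) = G q (y - q) := by
    filter_upwards [hN, hχ.eventuallyEq_nhds] with y hy hχy
    rw [metric_gradField (hG y hy)]
    have : f =ᶠ[𝓝 y] fun y ↦ (2 : ℝ)⁻¹ * G q (y - q) (y - q) := by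
      filter_upwards [hχy] with z hz
      simp only [f, hz, Pi.one_apply, one_mul]
    rw [this.fderiv_eq, (hd y).fderiv]
  obtain ⟨e, he⟩ := exists_equiv_of_posDef (hG q hq)
  have hinj : Function.Injective (G q) := by
    rw [← he]; exact e.injective
  have hZ0 : gradField G f q = 0 := hinj (by rw [hev.self_of_nhds, sub_self])
  refine ⟨f, hf, hZ0, ?_⟩
  have hZd := ((contDiffAt_gradField (hG q hq) (hGs q hq)
    (hf.1.contDiffAt (x := q))).differentiableAt (by simp)).hasFDerivAt
  have h1 := (((hGs q hq).differentiableAt (by simp)).hasFDerivAt.clm_apply hZd)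
  have h2 : HasFDerivAt (fun y ↦ G q (y - q)) (G q) q :=
    (G q).hasFDerivAt.comp q ((hasFDerivAt_id q).sub_const q)
  -- Differentiating that identity at q: the term with the derivative of G drops out because Z(q) =
  -- 0, leaving G_q DZ(q) = G_q.
  have h3 := h1.unique (h2.congr_of_eventuallyEq hev)
  ext w
  refine hinj ?_
  have h4 := DFunLike.congr_fun h3 w
  rw [hZ0] at h4
  simpa using h4

/-- The quadratic form governing the second fundamental form in the direction of `Z`. -/
noncomputable def secondForm (r : E → ℝ) (G : E → E →L[ℝ] E →L[ℝ] ℝ) (Z : E → E) (y v : E) : ℝ :=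
  G y v (fderiv ℝ Z y v) + (fderiv ℝ G y (Z y) v v + wDiv r Z y * G y v v) / 2

theorem secondForm_smul (r : E → ℝ) (G : E → E →L[ℝ] E →L[ℝ] ℝ) (Z : E → E) (y v : E) (t : ℝ) :
    secondForm r G Z y (t • v) = t ^ 2 * secondForm r G Z y v := by
  simp only [secondForm, map_smul, _root_.smul_apply, smul_eq_mul]
  ring

/-- At q the form equals (1 + dim E / 2) G. Positivity spreads to a neighbourhood uniformly over the
compact unit sphere, and to all nonzero vectors by homogeneity of degree two. -/
theorem eventually_secondForm_pos {r : E → ℝ} {G : E → E →L[ℝ] E →L[ℝ] ℝ} {Z : E → E} {q : E}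
    (hr : ContDiffAt ℝ ∞ r q) (hr0 : r q ≠ 0) (hGs : ContDiffAt ℝ ∞ G q)
    (hG : ∀ v, v ≠ 0 → 0 < G q v v)
    (hZs : ContDiffAt ℝ ∞ Z q) (hZ0 : Z q = 0)
    (hZ : fderiv ℝ Z q = ContinuousLinearMap.id ℝ E) :
    ∀ᶠ y in 𝓝 q, ∀ v, v ≠ 0 → 0 < secondForm r G Z y v := by
  have hq : ∀ v, v ≠ 0 → 0 < secondForm r G Z q v := by
    intro v hv
    have h1 : wDiv r Z q = Module.finrank ℝ E := by
      rw [wDiv, eDiv, hZ, hZ0, map_zero, mul_zero, add_zero, traceL_apply]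
      exact LinearMap.trace_id ℝ E
    rw [secondForm, h1, hZ, hZ0]
    simp only [map_zero, _root_.zero_apply, ContinuousLinearMap.id_apply, zero_add]
    have := hG v hv
    positivity
  have hc : ∀ v ∈ Metric.sphere (0 : E) 1, ∀ᶠ z : E × E in 𝓝 (q, v),
      0 < secondForm r G Z z.1 z.2 := by
    intro v hv
    have c1 : ContinuousAt (fun z : E × E ↦ G z.1) (q, v) :=
      ContinuousAt.comp (f := Prod.fst) hGs.continuousAt continuousAt_fst
    have c2 : ContinuousAt (fun z : E × E ↦ fderiv ℝ Z z.1) (q, v) :=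
      ContinuousAt.comp (f := Prod.fst) (hZs.fderiv_right (m := ∞) (by simp)).continuousAt
        continuousAt_fst
    have c3 : ContinuousAt (fun z : E × E ↦ fderiv ℝ G z.1) (q, v) :=
      ContinuousAt.comp (f := Prod.fst) (hGs.fderiv_right (m := ∞) (by simp)).continuousAt
        continuousAt_fst
    have c4 : ContinuousAt (fun z : E × E ↦ Z z.1) (q, v) :=
      ContinuousAt.comp (f := Prod.fst) hZs.continuousAt continuousAt_fst
    have c5 : ContinuousAt (fun z : E × E ↦ wDiv r Z z.1) (q, v) :=
      ContinuousAt.comp (f := Prod.fst) (g := wDiv r Z) (contDiffAt_wDiv hr hr0 hZs).continuousAt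
        continuousAt_fst
    have c6 : ContinuousAt (fun z : E × E ↦ z.2) (q, v) := continuousAt_snd
    have c : ContinuousAt (fun z : E × E ↦ secondForm r G Z z.1 z.2) (q, v) :=
      ((c1.clm_apply c6).clm_apply (c2.clm_apply c6)).add
        (((((c3.clm_apply c4).clm_apply c6).clm_apply c6).add
          (c5.mul ((c1.clm_apply c6).clm_apply c6))).div_const 2)
    refine c.eventually (lt_mem_nhds (hq v ?_))
    rintro rfl
    simp at hv
  have h := (isCompact_sphere (0 : E) 1).eventually_forall_of_forall_eventually
    (P := fun y v ↦ 0 < secondForm r G Z y v) hc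
  filter_upwards [h] with y hy v hv
  have h1 := hy (‖v‖⁻¹ • v) (by simp [norm_smul, hv])
  rw [secondForm_smul] at h1
  exact (mul_pos_iff_of_pos_left (by positivity)).1 h1

end Gradient

/-! ### Integrals in a chart -/

section EuclideanIntegrals

variable {E : Type*} [NormedAddCommGroup E] [NormedSpace ℝ E] [FiniteDimensional ℝ E]

theorem IsTest.mul_wDiv {U : Set E} {r : E → ℝ} (hr : ∀ y ∈ U, ContDiffAt ℝ ∞ r y)
    (hr0 : ∀ y ∈ U, 0 < r y) {F : E → E} (hF : IsTest U F) :
    IsTest U fun y ↦ r y * wDiv r F y := by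
  refine hF.of_support_subset
    (fun y hy ↦ (hr y hy).mul (contDiffAt_wDiv (hr y hy) (hr0 y hy).ne' hF.1.contDiffAt))
    fun y hy ↦ ?_
  by_contra h
  refine hy ?_
  have h0 : (0 : E → E) = fun _ ↦ 0 := rfl
  have h1 : wDiv r F y = 0 := by
    rw [wDiv_congr (notMem_tsupport_iff_eventuallyEq.1 h), wDiv, eDiv, h0, fderiv_fun_const]
    simp
  simp only [h1, mul_zero]

theorem IsTest.metric_lieBracket {U : Set E} {r : E → ℝ} {G : E → E →L[ℝ] E →L[ℝ] ℝ}
    (hr : ∀ y ∈ U, ContDiffAt ℝ ∞ r y) (hG : ∀ y ∈ U, ContDiffAt ℝ ∞ G y)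
    {X Z : E → E} (hX : IsTest U X) (hZ : ContDiff ℝ ∞ Z) :
    IsTest U fun y ↦ r y * G y (X y) (VectorField.lieBracket ℝ X Z y) := by
  refine hX.of_support_subset (fun y hy ↦ ?_) fun y hy ↦ subset_tsupport _ fun h ↦ hy ?_
  · have h1 : ContDiffAt ℝ ∞ (VectorField.lieBracket ℝ X Z) y :=
      ((hZ.fderiv_right (m := ∞) (by simp)).clm_apply hX.1 |>.sub
        ((hX.1.fderiv_right (m := ∞) (by simp)).clm_apply hZ)).contDiffAt
    exact (hr y hy).mul (((hG y hy).clm_apply hX.1.contDiffAt).clm_apply h1)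
  · simp only [h, map_zero, _root_.zero_apply, mul_zero]

variable [MeasurableSpace E] [BorelSpace E] {μ : Measure E} [μ.IsAddHaarMeasure]

theorem IsTest.integrable {U : Set E} {f : E → ℝ} (hf : IsTest U f) : Integrable f μ :=
  hf.1.continuous.integrable_of_hasCompactSupport hf.2

theorem IsTest.setIntegral_eq {U : Set E} {f : E → ℝ} (hf : IsTest U f) :
    ∫ y in U, f y ∂μ = ∫ y, f y ∂μ :=
  setIntegral_eq_integral_of_forall_compl_eq_zero fun _ hy ↦
    image_eq_zero_of_notMem_tsupport fun h ↦ hy (hf.3 h)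

/-- Divergence free fields are orthogonal to gradients. -/
theorem setIntegral_mul_fderiv_eq_zero {U : Set E} (hU : IsOpen U) {r : E → ℝ}
    (hr : ∀ y ∈ U, ContDiffAt ℝ ∞ r y) (hr0 : ∀ y ∈ U, 0 < r y) {W : E → E}
    (hW : ∀ y ∈ U, ContDiffAt ℝ ∞ W y) (hW0 : ∀ y ∈ U, wDiv r W y = 0) {f : E → ℝ}
    (hf : IsTest U f) : ∫ y in U, r y * fderiv ℝ f y (W y) ∂μ = 0 := by
  have h := hf.smul hW
  rw [← setIntegral_mul_wDiv_eq_zero (μ := μ) hU hr hr0 h.1 h.2 h.3]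
  refine setIntegral_congr_fun hU.measurableSet fun y hy ↦ ?_
  -- As W is divergence free, the integrand is the density times div(fW).
  rw [wDiv_smul (hf.1.differentiable (by simp) y) ((hW y hy).differentiableAt (by simp)),
    hW0 y hy, mul_zero, zero_add]

/-- The only term with a derivative of X is -G(X, DX·Z). Adding half the divergence of G(X,X) Z,
which integrates to zero, cancels it by symmetry of G and leaves the density times `secondForm`, a
pointwise quadratic expression in X. This is nonnegative, continuous and positive at q. -/
theorem setIntegral_metric_lieBracket_pos {U : Set E} (hU : IsOpen U) {r : E → ℝ}
    (hr : ∀ y ∈ U, ContDiffAt ℝ ∞ r y) (hr0 : ∀ y ∈ U, 0 < r y)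
    {G : E → E →L[ℝ] E →L[ℝ] ℝ} (hG : ∀ y ∈ U, ContDiffAt ℝ ∞ G y)
    (hsymm : ∀ y v w, G y v w = G y w v) {X Z : E → E} (hX : IsTest U X) (hZ : IsTest U Z)
    (hpos : ∀ y ∈ U, X y ≠ 0 → 0 < secondForm r G Z y (X y)) {q : E} (hq : q ∈ U)
    (hXq : X q ≠ 0) :
    0 < ∫ y in U, r y * G y (X y) (VectorField.lieBracket ℝ X Z y) ∂μ := by
  have hg : ∀ y ∈ U, ContDiffAt ℝ ∞ (fun y ↦ G y (X y) (X y)) y := fun y hy ↦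
    ((hG y hy).clm_apply hX.1.contDiffAt).clm_apply hX.1.contDiffAt
  have h1 := hX.metric_lieBracket hr hG hZ.1
  have hgZ : IsTest U fun y ↦ G y (X y) (X y) • Z y := hZ.smul_left hg
  have h2 := IsTest.mul_wDiv hr hr0 hgZ
  have h0 := setIntegral_mul_wDiv_eq_zero (μ := μ) hU hr hr0 hgZ.1 hgZ.2 hgZ.3
  rw [h2.setIntegral_eq] at h0
  rw [h1.setIntegral_eq]
  have h3 : ∀ y ∈ U, r y * G y (X y) (VectorField.lieBracket ℝ X Z y) +
      2⁻¹ * (r y * wDiv r (fun y ↦ G y (X y) (X y) • Z y) y) =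
        r y * secondForm r G Z y (X y) := by
    intro y hy
    have hXd := (hX.1.differentiable (by simp) y).hasFDerivAt
    have hd := ((((hG y hy).differentiableAt (by simp)).hasFDerivAt.clm_apply hXd).clm_apply
      hXd).fderiv
    rw [wDiv_smul ((hg y hy).differentiableAt (by simp)) (hZ.1.differentiable (by simp) y), hd,
      VectorField.lieBracket, secondForm]
    simp only [_root_.add_apply, ContinuousLinearMap.comp_apply, ContinuousLinearMap.flip_apply,
      map_sub]
    rw [hsymm y (fderiv ℝ X y (Z y)) (X y)]
    ring
  have hk := (h1.1.add (contDiff_const (c := (2⁻¹ : ℝ)).mul h2.1)).continuous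
  have hc : HasCompactSupport fun y ↦ r y * G y (X y) (VectorField.lieBracket ℝ X Z y) +
      2⁻¹ * (r y * wDiv r (fun y ↦ G y (X y) (X y) • Z y) y) :=
    h1.2.add h2.2.mul_left
  have hnn : ∀ y, 0 ≤ r y * G y (X y) (VectorField.lieBracket ℝ X Z y) +
      2⁻¹ * (r y * wDiv r (fun y ↦ G y (X y) (X y) • Z y) y) := by
    intro y
    by_cases hy : y ∈ U
    · rw [h3 y hy]
      refine mul_nonneg (hr0 y hy).le ?_
      by_cases hXy : X y = 0
      · simp [hXy, secondForm]
      · exact (hpos y hy hXy).le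
    · have e1 := image_eq_zero_of_notMem_tsupport fun h ↦ hy (h1.3 h)
      have e2 := image_eq_zero_of_notMem_tsupport fun h ↦ hy (h2.3 h)
      rw [e1, e2, mul_zero, add_zero]
  have hp := hk.integral_pos_of_hasCompactSupport_nonneg_nonzero (μ := μ) hc hnn (x := q)
    (by rw [h3 q hq]; exact (mul_pos (hr0 q hq) (hpos q hq hXq)).ne')
  rwa [integral_add h1.integrable (h2.integrable.const_mul _), integral_const_mul, h0, mul_zero,
    add_zero] at hp

/-- There is a divergence free field with small support which does not vanish at a given point. -/
theorem exists_curlField_ne_zero {N : Set E} {q : E} (hN : N ∈ 𝓝 q) {u w : E} {l : E →L[ℝ] ℝ}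
    (hu : u ≠ 0) (hlu : l u = 0) (hlw : l w = 1) :
    ∃ ψ, IsTest N ψ ∧ curlField ψ u w q ≠ 0 := by
  obtain ⟨χ, hχ1, hχ2, hχ3, hχ⟩ := exists_smooth_bump hN
  -- Near q this is the linear function l, whose curl is l(w) u - l(u) w = u.
  refine ⟨fun y ↦ χ y * l y, IsTest.mul ⟨hχ1, hχ2, hχ3⟩ fun y _ ↦ l.contDiff.contDiffAt, ?_⟩
  have h : (fun y ↦ χ y * l y) =ᶠ[𝓝 q] l := by
    filter_upwards [hχ] with y hy
    rw [hy, Pi.one_apply, one_mul]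
  rw [curlField, h.fderiv_eq, l.fderiv, hlw, hlu, one_smul, zero_smul, sub_zero]
  exact hu

end EuclideanIntegrals

/-! ### The main argument -/

section Main

variable {n : ℕ} {M : Type*} [TopologicalSpace M]
  [ChartedSpace (EuclideanSpace ℝ (Fin n)) M] [IsManifold (𝓡 n) ∞ M] [T2Space M]
  [RiemannianBundle (fun x : M ↦ TangentSpace (𝓡 n) x)]

theorem divergenceFree_eq_univ_of_dim_eq_zero (hn : n = 0) (o : ManifoldOrientation n M) :
    divergenceFree o = univ := by
  subst hn
  refine eq_univ_of_forall fun X V x ↦ ?_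
  have h : X x = 0 := Subsingleton.elim (α := EuclideanSpace ℝ (Fin 0)) _ _
  rw [lieDerivVolForm, h, map_zero, Finset.univ_eq_empty, Finset.sum_empty, sub_zero]

variable [IsContMDiffRiemannianBundle (𝓡 n) ∞ (EuclideanSpace ℝ (Fin n))
      (fun x : M ↦ TangentSpace (𝓡 n) x)]

theorem continuous_inner (X Y : SmoothVF n M) : Continuous fun x ↦ inner ℝ (X x) (Y x) :=
  (ContMDiff.inner_bundle X.contMDiff Y.contMDiff).continuous

variable [CompactSpace M] [MeasurableSpace M] [BorelSpace M]

theorem innerL2_eq (o : ManifoldOrientation n M) {p : M} {X Y : SmoothVF n M}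
    (h : ∀ x ∉ (extChartAt (𝓡 n) p).source, inner ℝ (X x) (Y x) = 0) :
    innerL2 o X Y = ∫ y in (extChartAt (𝓡 n) p).target,
      density o p y * metricRep p y (localRep p X y) (localRep p Y y) := by
  rw [innerL2, integral_volMeasure_eq o p (continuous_inner X Y).aestronglyMeasurable h]
  refine setIntegral_congr_fun (isOpen_extChartAt_target p).measurableSet fun y hy ↦ ?_
  rw [inner_eq_metricRep p X Y hy]

/-- Pairing W with a gradient gives the integral of df(W), which vanishes by the divergence theorem.
-/
theorem innerL2_ofChart_gradField (hn : 0 < n) {o : ManifoldOrientation n M} {p : M}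
    {W : SmoothVF n M} (hW : W ∈ divergenceFree o) {f : EuclideanSpace ℝ (Fin n) → ℝ}
    (hf : IsTest (extChartAt (𝓡 n) p).target f)
    (h : IsTest (extChartAt (𝓡 n) p).target (gradField (metricRep p) f)) :
    innerL2 o W (ofChart p (gradField (metricRep p) f) h.1 h.2 h.3) = 0 := by
  have hT := isOpen_extChartAt_target (I := 𝓡 n) p
  rw [innerL2_eq o (p := p) fun x hx ↦ by rw [ofChart_apply_of_notMem hx, inner_zero_right]]
  rw [← setIntegral_mul_fderiv_eq_zero (μ := volume) hT (fun y hy ↦ contDiffAt_density o hy)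
    (fun y hy ↦ density_pos o hy) (fun y hy ↦ localRep_contDiffAt p W hy)
    (fun y hy ↦ (divVF_symm_eq o hn W hy).symm.trans ((mem_divergenceFree_iff o hn W).1 hW _)) hf]
  refine setIntegral_congr_fun hT.measurableSet fun y hy ↦ ?_
  rw [localRep_ofChart hy, metricRep_comm, metric_gradField fun v hv ↦ metricRep_self_pos hy hv]

theorem innerL2_lie_ofChart (o : ManifoldOrientation n M) {p : M}
    {F H : EuclideanSpace ℝ (Fin n) → EuclideanSpace ℝ (Fin n)}
    (hF : IsTest (extChartAt (𝓡 n) p).target F) (hH : IsTest (extChartAt (𝓡 n) p).target H) :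
    innerL2 o (ofChart p F hF.1 hF.2 hF.3)
        ⁅ofChart p F hF.1 hF.2 hF.3, ofChart p H hH.1 hH.2 hH.3⁆ =
      ∫ y in (extChartAt (𝓡 n) p).target,
        density o p y * metricRep p y (F y) (VectorField.lieBracket ℝ F H y) := by
  rw [innerL2_eq o (p := p) fun x hx ↦ by rw [ofChart_apply_of_notMem hx, inner_zero_left]]
  refine setIntegral_congr_fun (isOpen_extChartAt_target p).measurableSet fun y hy ↦ ?_
  rw [localRep_ofChart hy, localRep_lie p _ _ hy, (localRep_ofChart_eventuallyEq hy
    (F := F)).lieBracket_vectorField_eq (localRep_ofChart_eventuallyEq hy (F := H))]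

theorem not_isTotallyGeodesic [ConnectedSpace M] (hn : 2 ≤ n) (o : ManifoldOrientation n M)
    {𝔤 : LieSubalgebra ℝ (SmoothVF n M)} (h𝔤 : divergenceFree o ⊂ (𝔤 : Set (SmoothVF n M)))
    {adT : 𝔤 →ₗ[ℝ] (𝔤 →L[ℝ] 𝔤)} (hadT : IsAdTranspose o 𝔤 adT) :
    ¬ IsTotallyGeodesic adT (divergenceFree o) := by
  intro hgeo
  have hn0 : 0 < n := by omega
  obtain ⟨hsub, Y, hY, hY'⟩ := (ssubset_iff_exists (s := divergenceFree o)).1 h𝔤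
  obtain ⟨p, q, hq, hd⟩ := exists_fderiv_chartDiv_ne_zero o hn0 hY'
  obtain ⟨N, hNq, hNT, hN⟩ := exists_nhds_chartMem hn hsub hY hq hd
  obtain ⟨f, hf, hZ0, hZ1⟩ := exists_gradField_radial (G := metricRep p) hNq
    (fun y hy v hv ↦ metricRep_self_pos (hNT hy) hv) (fun y hy ↦ contDiffAt_metricRep (hNT hy))
    (metricRep_comm p q)
  have hZN := isTest_gradField (G := metricRep p)
    (fun y hy v hv ↦ metricRep_self_pos (p := p) (hNT hy) hv)
    (fun y hy ↦ contDiffAt_metricRep (hNT hy)) hf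
  obtain ⟨hZ, hZ𝔤⟩ := hN _ hZN
  have hpos := eventually_secondForm_pos (contDiffAt_density o hq) (density_pos o hq).ne'
    (contDiffAt_metricRep hq) (fun v hv ↦ metricRep_self_pos hq hv) hZ.1.contDiffAt hZ0 hZ1
  obtain ⟨u, hu⟩ : ∃ u : EuclideanSpace ℝ (Fin n), u ≠ 0 :=
    ⟨EuclideanSpace.single ⟨0, hn0⟩ 1, by simp⟩
  obtain ⟨l, w, hlu, hlw⟩ := exists_dual_eq_zero_ne_zero hn u
  -- The potential is supported where `secondForm` is positive definite, so X is nonzero only at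
  -- such points.
  obtain ⟨ψ, hψ, hψq⟩ := exists_curlField_ne_zero
    (inter_mem ((isOpen_extChartAt_target p).mem_nhds hq) hpos) hu hlu hlw
  have hXN := isTest_inv_density_smul_curlField (o := o) inter_subset_left hψ u w
  have hX := hXN.mono inter_subset_left
  have hXd := ofChart_mem_divergenceFree hn0 hX fun y hy ↦
    wDiv_inv_density_smul_curlField (o := o) hy hψ.1
  -- This reads ⟨ad(X)ᵀX, Z⟩ = ⟨X, [X,Z]⟩. The left side is zero by total geodesy and orthogonality
  -- to gradients; the right side is positive.
  have h1 := hadT ⟨_, hsub hXd⟩ ⟨_, hsub hXd⟩ ⟨_, hZ𝔤⟩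
  rw [innerL2_ofChart_gradField hn0 (hgeo ⟨_, hsub hXd⟩ hXd) (hf.mono hNT) hZ] at h1
  refine h1.not_lt ?_
  rw [LieSubalgebra.coe_bracket, innerL2_lie_ofChart o hX hZ]
  refine setIntegral_metric_lieBracket_pos (isOpen_extChartAt_target p)
    (fun y hy ↦ contDiffAt_density o hy) (fun y hy ↦ density_pos o hy)
    (fun y hy ↦ contDiffAt_metricRep hy) (metricRep_comm p) hX hZ (fun y _ hy0 ↦ ?_) hq
    (smul_ne_zero (inv_ne_zero (density_pos o hq).ne') hψq)
  exact (hXN.3 (subset_tsupport _ hy0)).2 _ hy0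

end Main

end VolGeodesic

theorem mainTheorem5 (n : ℕ) (hn : n ≠ 1) (M : Type*) [TopologicalSpace M]
    [ChartedSpace (EuclideanSpace ℝ (Fin n)) M] [IsManifold (𝓡 n) ∞ M]
    [T2Space M] [CompactSpace M] [ConnectedSpace M] [MeasurableSpace M] [BorelSpace M]
    [RiemannianBundle (fun x : M ↦ TangentSpace (𝓡 n) x)]
    [IsContMDiffRiemannianBundle (𝓡 n) ∞ (EuclideanSpace ℝ (Fin n))
      (fun x : M ↦ TangentSpace (𝓡 n) x)]
    (o : VolGeodesic.ManifoldOrientation n M) :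
    ¬ ∃ 𝔤 : LieSubalgebra ℝ (VolGeodesic.SmoothVF n M),
      IsClosed (𝔤 : Set (VolGeodesic.SmoothVF n M)) ∧
      VolGeodesic.divergenceFree o ⊂ (𝔤 : Set (VolGeodesic.SmoothVF n M)) ∧
      ∃ adT : 𝔤 →ₗ[ℝ] (𝔤 →L[ℝ] 𝔤),
        VolGeodesic.IsAdTranspose o 𝔤 adT ∧
        VolGeodesic.IsBoundedOperatorValued adT ∧
        VolGeodesic.IsTotallyGeodesic adT (VolGeodesic.divergenceFree o) := by
  rintro ⟨𝔤, -, h𝔤, adT, hadT, -, hgeo⟩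
  -- In dimension zero every field vanishes and is divergence free, so the inclusion cannot be
  -- strict.
  by_cases h0 : n = 0
  · refine h𝔤.2 ?_
    rw [VolGeodesic.divergenceFree_eq_univ_of_dim_eq_zero h0 o]
    exact subset_univ _
  · exact VolGeodesic.not_isTotallyGeodesic (by omega) o h𝔤 hadT hgeo
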